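/- \textbf{Setting.} Let $\rho>1$ be an integer, let $n\ge 0$, and let $H=(V_H,E_H)$ be a finite directed acyclic graph whose vertices belong to an $n$-element set $V$ (the jobs of the whole instance). For a vertex $v$ of $H$ let $A_H(v)$ be the set of vertices of $H$ with a directed path to $v$, including $v$ itself, and let $A_H(S)=\bigcup_{v\in S}A_H(v)$; let $E_H(v)$ and $E_H(S)$ be the sets of edges of $H$ induced by $A_H(v)$ and by $A_H(S)$. For $v\notin V_H$ put $A_H(v)=\emptyset$. Assume that $H$ is small: $|A_H(v)|\le 2\rho$ for all $v\in V_H$. Let $0<\gamma<1/4$ and let $N\ge 1$ be an integer. \textbf{Estimates.} The size of a subset $S$ of a $u$-element universe is estimated as follows, with $t=9c$ (that is, $c/\varepsilon^2$ with $\varepsilon=1/3$) and $k=\lceil c'\ln n\rceil$. Draw $k$ independent uniform members of a given 2-universal (pairwise independent) family of hash functions into $\{1,\dots,u^3\}$. For each of them let $\ell$ be the $t$-th smallest of the distinct hash values of $S$ and take the number $t u^3/\ell$; if there are fewer than $t$ distinct hash values, take their number. The estimate is the median of the $k$ numbers. "Obtain estimates in a graph" means: with newly drawn hash functions (one set for all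 vertices, one set for all edges), compute estimates $\hat a(v)$ of $|A(v)|$ and $\hat e(v)$ of $|E(v)|$ in that graph for all $v$. \textbf{FindBatch.} Start with $B=\emptyset$. Obtain estimates in $H$ and put $v\in V_H$ into the bucket $K_i$ with $2^i\le\hat e(v)<2^{i+1}$, or into $K_0$ if $\hat e(v)<1$. While some bucket is non-empty, do the following. First, for all $i$ in decreasing order, draw vertices $v$ uniformly without replacement from $K_i$ until $K_i$ is empty or $N$ consecutive draws were stale; here $v$ is fresh, and is added to $B$, if $$|A_H(v)\setminus A_H(B)|>\gamma|A_H(v)|\quad\text{and}\quad \bigl(E_H(v)=\emptyset\ \text{ or }\ |E_H(v)\setminus E_H(B)|>\gamma|E_H(v)|\bigr),$$ and it is stale otherwise. Then prune: obtain new estimates $\hat a,\hat e$ in $H$ and $\hat a',\hat e'$ in $H\setminus A_H(B)$, and remove from its bucket each $v$ with $\hat a'(v)/\hat a(v)\le 2\gamma$, or with $\hat e(v)\ne 0$ and $\hat e'(v)/\hat e(v)\le 2\gamma$. When all buckets are empty, return the batch $B$. \textbf{ScheduleSmallSubgraph.} While $H$ is non-empty, let $B$ be the result of FindBatch for $H$,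 schedule $A_H(v)$ for all $v\in B$, and remove the vertices in $A_H(B)$ and all edges adjacent to them from $H$. \textbf{Lemma.} With high probability, the number of batches that ScheduleSmallSubgraph needs before all vertices of $H$ are scheduled is at most $$\max\bigl\{3,\ 4\log_{1/(4\gamma)}(2\rho)\bigr\}.$$ Precisely: for every sufficiently large integer $c$ and every real $d\ge1$ there is $c_1$ such that for all integers $c'\ge c_1$ and all $V$, $H$, $\rho$, $\gamma$, $N$ and hash families as above, the bound holds with probability at least $1-1/n^d$. -/

import Mathlib

namespace BatchScheduling

noncomputable section

open scoped Classical

/-! ### Precedence graphs -/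

/-- A finite directed acyclic graph whose vertices are among the elements of `V`. -/
structure DAG (V : Type*) where
  verts : Finset V
  edges : Finset (V × V)
  edges_mem : ∀ e ∈ edges, e.1 ∈ verts ∧ e.2 ∈ verts
  acyclic : ∀ v, ¬ Relation.TransGen (fun a b => (a, b) ∈ edges) v v

namespace DAG

variable {V : Type*}

/-- The ancestors of `v` in `H`, that is, the vertices of `H` with a directed path (possibly of
length zero) to `v`. A vertex of `H` is an ancestor of itself; if `v` is not a vertex of `H`, the
set is empty. -/
def anc (H : DAG V) (v : V) : Finset V :=
  H.verts.filter fun u => Relation.ReflTransGen (fun a b => (a, b) ∈ H.edges) u v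

/-- The ancestors of a set of vertices. -/
def ancSet (H : DAG V) (S : Finset V) : Finset V := S.biUnion H.anc

/-- The edges of the subgraph of `H` induced by the vertex set `A`. -/
def inducedEdges (H : DAG V) (A : Finset V) : Finset (V × V) :=
  H.edges.filter fun e => e.1 ∈ A ∧ e.2 ∈ A

/-- The edges induced by the ancestors of `v`. -/
def ancEdges (H : DAG V) (v : V) : Finset (V × V) := H.inducedEdges (H.anc v)

/-- The edges induced by the ancestors of a set of vertices. -/
def ancEdgesSet (H : DAG V) (S : Finset V) : Finset (V × V) := H.inducedEdges (H.ancSet S)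

/-- `H` with the vertices in `A` and all edges adjacent to them removed. -/
def remove (H : DAG V) (A : Finset V) : DAG V where
  verts := H.verts \ A
  edges := H.edges.filter fun e => e.1 ∉ A ∧ e.2 ∉ A
  edges_mem := by
    intro e he
    rw [Finset.mem_filter] at he
    have h := H.edges_mem e he.1
    exact ⟨Finset.mem_sdiff.2 ⟨h.1, he.2.1⟩, Finset.mem_sdiff.2 ⟨h.2, he.2.2⟩⟩
  acyclic := by
    intro v hv
    have key : ∀ a b, Relation.TransGen
        (fun a b => (a, b) ∈ H.edges.filter fun e => e.1 ∉ A ∧ e.2 ∉ A) a b →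
        Relation.TransGen (fun a b => (a, b) ∈ H.edges) a b := by
      intro a b h
      induction h with
      | single h => exact Relation.TransGen.single (Finset.mem_filter.1 h).1
      | tail _ h ih => exact ih.tail (Finset.mem_filter.1 h).1
    exact H.acyclic v (key v v hv)

/-- A small subgraph: each vertex has at most `2ρ` ancestors. -/
def IsSmall (H : DAG V) (ρ : ℕ) : Prop := ∀ v ∈ H.verts, (H.anc v).card ≤ 2 * ρ

theorem self_mem_anc (H : DAG V) {v : V} (hv : v ∈ H.verts) : v ∈ H.anc v :=
  Finset.mem_filter.2 ⟨hv, Relation.ReflTransGen.refl⟩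

end DAG

/-! ### The count-distinct estimator -/

/-- A 2-universal (pairwise independent) family of hash functions from `U` to a set of `N` hash
values: for a uniformly random seed, any two distinct elements of `U` have independent, uniformly
distributed hash values. -/
structure HashFamily (U : Type*) (N : ℕ) where
  Seed : Type
  [fintypeSeed : Fintype Seed]
  [nonemptySeed : Nonempty Seed]
  hash : Seed → U → Fin N
  two_universal : ∀ x y : U, x ≠ y → ∀ a b : Fin N,
    (Finset.univ.filter fun s : Seed => hash s x = a ∧ hash s y = b).card * N ^ 2 =
      Fintype.card Seed

attribute [instance] HashFamily.fintypeSeed HashFamily.nonemptySeed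

/-- The (at most) `t` smallest distinct hash values, in increasing order, of the elements of `S`.
Hash values range over `1, …, N`. -/
def smallestValues {U : Type*} {N : ℕ} (t : ℕ) (h : U → Fin N) (S : Finset U) : List ℕ :=
  ((S.image fun x => (h x : ℕ) + 1).sort (· ≤ ·)).take t

/-- The estimate of `|S|` from one hash function: `tN/ℓ` with `ℓ` the `t`-th smallest hash value;
if there are fewer than `t` hash values, their number. -/
def singleEstimate {U : Type*} {N : ℕ} (t : ℕ) (h : U → Fin N) (S : Finset U) : ℝ :=
  if (smallestValues t h S).length < t then ((smallestValues t h S).length : ℝ)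
  else (t : ℝ) * (N : ℝ) / (((smallestValues t h S).getLastD 1 : ℕ) : ℝ)

/-- The median of a list of real numbers (the upper one for a list of even length). -/
def median (l : List ℝ) : ℝ := (l.insertionSort (· ≤ ·)).getD (l.length / 2) 0

/-- The estimate of `|S|` from `k` hash functions: the median of the single estimates. -/
def estimate {U : Type*} {N : ℕ} (F : HashFamily U N) (t k : ℕ) (seeds : Fin k → F.Seed)
    (S : Finset U) : ℝ :=
  median (List.ofFn fun i => singleEstimate t (F.hash (seeds i)) S)

/-! ### The scheduling algorithm -/

/-- The parameters of the algorithm: the freshness threshold `γ`, the number `N` of consecutive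
stale vertices after which the sampling of a bucket stops, the number `t` of hash values kept for
each hash function, the number `k` of hash functions of an estimator, and the hash families for
vertices and for edges (a set of size `u` is hashed to `u ^ 3` values). -/
structure Params (V : Type*) [Fintype V] where
  γ : ℝ
  γ_pos : 0 < γ
  γ_lt : γ < 1 / 2
  N : ℕ
  N_pos : 0 < N
  t : ℕ
  k : ℕ
  vertHash : HashFamily V (Fintype.card V ^ 3)
  edgeHash : HashFamily (V × V) (Fintype.card (V × V) ^ 3)

variable {V : Type*} [Fintype V]

/-- Estimates, with newly drawn independent uniform hash functions, of the number of ancestors and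
of the number of ancestor edges of all vertices in `H`. -/
def estimates (P : Params V) (H : DAG V) : PMF ((V → ℝ) × (V → ℝ)) :=
  (PMF.uniformOfFintype (Fin P.k → P.vertHash.Seed)).bind fun σ =>
    (PMF.uniformOfFintype (Fin P.k → P.edgeHash.Seed)).bind fun τ =>
      PMF.pure (fun v => estimate P.vertHash P.t P.k σ (H.anc v),
        fun v => estimate P.edgeHash P.t P.k τ (H.ancEdges v))

/-- `v` is fresh with respect to the current batch `B`: more than a `γ`-fraction of its ancestors
and of its ancestor edges is not yet covered by `B`. If there are no ancestor edges, there is no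
condition on them. -/
def Fresh (P : Params V) (H : DAG V) (B : Finset V) (v : V) : Prop :=
  P.γ * ((H.anc v).card : ℝ) < ((H.anc v \ H.ancSet B).card : ℝ) ∧
    (H.ancEdges v = ∅ ∨
      P.γ * ((H.ancEdges v).card : ℝ) < ((H.ancEdges v \ H.ancEdgesSet B).card : ℝ))

/-- The index `i` with `2 ^ i ≤ x < 2 ^ (i + 1)`; the smallest index, `0`, if `x < 1`. -/
def bucketIndex (x : ℝ) : ℕ := Nat.log 2 ⌊x⌋₊

/-- The `i`-th bucket, where `R` is the set of all vertices that are still in some bucket and `idx`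
assigns to each vertex the index of its bucket. -/
def bucket (idx : V → ℕ) (i : ℕ) (R : Finset V) : Finset V := R.filter fun v => idx v = i

/-- Sample uniformly without replacement from the `i`-th bucket, adding the fresh vertices to the
batch `B`, until the bucket is empty or `N` consecutive samples were stale (`s` counts them).
Returns the vertices still in buckets and the new batch. -/
def sampleBucket (P : Params V) (H : DAG V) (idx : V → ℕ) (i : ℕ)
    (R B : Finset V) (s : ℕ) : PMF (Finset V × Finset V) :=
  if h : s < P.N ∧ (bucket idx i R).Nonempty then
    (PMF.uniformOfFinset (bucket idx i R) h.2).bindOnSupport fun v hv =>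
      if Fresh P H B v then sampleBucket P H idx i (R.erase v) (insert v B) 0
      else sampleBucket P H idx i (R.erase v) B (s + 1)
  else PMF.pure (R, B)
termination_by R.card
decreasing_by
  all_goals
    rw [PMF.mem_support_uniformOfFinset_iff] at hv
    exact Finset.card_erase_lt_of_mem (Finset.mem_filter.1 hv).1

/-- Sample from the buckets `j - 1, …, 1, 0`, in this order. -/
def sampleBuckets (P : Params V) (H : DAG V) (idx : V → ℕ) :
    ℕ → Finset V → Finset V → PMF (Finset V × Finset V)
  | 0, R, B => PMF.pure (R, B)
  | j + 1, R, B => (sampleBucket P H idx j R B 0).bind fun r => sampleBuckets P H idx j r.1 r.2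

/-- Prune the buckets: estimate again in `H` and in `H` without the ancestors of `B`, and remove
the vertices for which one of the two ratios of the estimates is at most `2γ`. There is no ratio
for the edges if their number is estimated to be zero in `H`. -/
def prune (P : Params V) (H : DAG V) (B R : Finset V) : PMF (Finset V) :=
  (estimates P H).bind fun e =>
    (estimates P (H.remove (H.ancSet B))).bind fun e' =>
      PMF.pure (R.filter fun v =>
        ¬ (e'.1 v / e.1 v ≤ 2 * P.γ ∨ (e.2 v ≠ 0 ∧ e'.2 v / e.2 v ≤ 2 * P.γ)))

/-- One sampling pass over all buckets in decreasing order, followed by pruning. -/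
def samplePass (P : Params V) (H : DAG V) (idx : V → ℕ) (R B : Finset V) :
    PMF (Finset V × Finset V) :=
  (sampleBuckets P H idx (Finset.univ.sup idx + 1) R B).bind fun r =>
    (prune P H r.2 r.1).bind fun R' => PMF.pure (R', r.2)

/-! Facts used for the termination of the two outer loops. -/

theorem sampleBucket_support (P : Params V) (H : DAG V) (idx : V → ℕ) (i : ℕ) :
    ∀ (n : ℕ) (R B : Finset V) (s : ℕ), R.card = n →
      ∀ r ∈ (sampleBucket P H idx i R B s).support, r.1 ⊆ R ∧ B ⊆ r.2 := by
  intro n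
  induction n with
  | zero =>
    intro R B s hR r hr
    rw [sampleBucket] at hr
    have hR' : R = ∅ := Finset.card_eq_zero.1 hR
    have hb : ¬ (s < P.N ∧ (bucket idx i R).Nonempty) := by
      subst hR'; simp [bucket]
    rw [dif_neg hb, PMF.support_pure, Set.mem_singleton_iff] at hr
    subst hr
    exact ⟨subset_rfl, subset_rfl⟩
  | succ n ih =>
    intro R B s hR r hr
    rw [sampleBucket] at hr
    split_ifs at hr with h
    · rw [PMF.mem_support_bindOnSupport_iff] at hr
      obtain ⟨v, hv, hr⟩ := hr
      have hvR : v ∈ R :=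
        (Finset.mem_filter.1 ((PMF.mem_support_uniformOfFinset_iff _ _).1 hv)).1
      have hc : (R.erase v).card = n := by rw [Finset.card_erase_of_mem hvR, hR]; rfl
      split_ifs at hr with hf
      · have := ih _ _ _ hc r hr
        exact ⟨this.1.trans (Finset.erase_subset _ _), (Finset.subset_insert _ _).trans this.2⟩
      · have := ih _ _ _ hc r hr
        exact ⟨this.1.trans (Finset.erase_subset _ _), this.2⟩
    · rw [PMF.support_pure, Set.mem_singleton_iff] at hr
      subst hr
      exact ⟨subset_rfl, subset_rfl⟩

theorem fresh_empty (P : Params V) (H : DAG V) {v : V} (hv : v ∈ H.verts) : Fresh P H ∅ v := by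
  have h0 : H.ancSet ∅ = ∅ := by simp [DAG.ancSet]
  have h1 : H.ancEdgesSet ∅ = ∅ := by simp [DAG.ancEdgesSet, DAG.inducedEdges, h0]
  have hγ : P.γ < 1 := P.γ_lt.trans (by norm_num)
  have hpos : (0 : ℝ) < (H.anc v).card := by
    exact_mod_cast Finset.card_pos.2 ⟨v, H.self_mem_anc hv⟩
  refine ⟨?_, ?_⟩
  · rw [h0, Finset.sdiff_empty]; nlinarith
  · rw [h1, Finset.sdiff_empty]
    rcases (H.ancEdges v).eq_empty_or_nonempty with he | he
    · exact Or.inl he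
    · right
      have : (0 : ℝ) < (H.ancEdges v).card := by exact_mod_cast Finset.card_pos.2 he
      nlinarith

theorem sampleBucket_progress (P : Params V) (H : DAG V) (idx : V → ℕ) (i : ℕ) (R B : Finset V)
    (hne : (bucket idx i R).Nonempty) :
    ∀ r ∈ (sampleBucket P H idx i R B 0).support,
      r.1 ⊂ R ∧ (R ⊆ H.verts → r.2.Nonempty) := by
  intro r hr
  rw [sampleBucket, dif_pos ⟨P.N_pos, hne⟩, PMF.mem_support_bindOnSupport_iff] at hr
  obtain ⟨v, hv, hr⟩ := hr
  have hvR : v ∈ R :=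
    (Finset.mem_filter.1 ((PMF.mem_support_uniformOfFinset_iff _ _).1 hv)).1
  split_ifs at hr with hf
  · have := sampleBucket_support P H idx i _ _ _ _ rfl r hr
    exact ⟨lt_of_le_of_lt this.1 (Finset.erase_ssubset hvR),
      fun _ => ⟨v, this.2 (Finset.mem_insert_self _ _)⟩⟩
  · have := sampleBucket_support P H idx i _ _ _ _ rfl r hr
    refine ⟨lt_of_le_of_lt this.1 (Finset.erase_ssubset hvR), fun hRV => ?_⟩
    rcases B.eq_empty_or_nonempty with hB | hB
    · subst hB
      exact absurd (fresh_empty P H (hRV hvR)) hf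
    · exact hB.mono this.2

theorem sampleBuckets_support (P : Params V) (H : DAG V) (idx : V → ℕ) :
    ∀ (j : ℕ) (R B : Finset V), ∀ r ∈ (sampleBuckets P H idx j R B).support,
      r.1 ⊆ R ∧ B ⊆ r.2 ∧ ((∃ v ∈ R, idx v < j) → r.1 ⊂ R ∧ (R ⊆ H.verts → r.2.Nonempty)) := by
  intro j
  induction j with
  | zero =>
    intro R B r hr
    rw [sampleBuckets, PMF.support_pure, Set.mem_singleton_iff] at hr
    subst hr
    exact ⟨subset_rfl, subset_rfl, fun ⟨v, _, h⟩ => absurd h (Nat.not_lt_zero _)⟩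
  | succ j ih =>
    intro R B r hr
    rw [sampleBuckets, PMF.mem_support_bind_iff] at hr
    obtain ⟨q, hq, hr⟩ := hr
    have h1 := sampleBucket_support P H idx j _ _ _ _ rfl q hq
    have h2 := ih _ _ r hr
    refine ⟨h2.1.trans h1.1, h1.2.trans h2.2.1, fun ⟨v, hv, hj⟩ => ?_⟩
    by_cases hne : (bucket idx j R).Nonempty
    · have h3 := sampleBucket_progress P H idx j R B hne q hq
      exact ⟨lt_of_le_of_lt h2.1 h3.1, fun hRV => (h3.2 hRV).mono h2.2.1⟩
    · have hvj : idx v ≠ j := fun hvj => hne ⟨v, Finset.mem_filter.2 ⟨hv, hvj⟩⟩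
      rw [sampleBucket, dif_neg (fun h => hne h.2), PMF.support_pure,
        Set.mem_singleton_iff] at hq
      subst hq
      exact h2.2.2 ⟨v, hv, by omega⟩

theorem samplePass_support (P : Params V) (H : DAG V) (idx : V → ℕ) (R B : Finset V)
    (hR : R.Nonempty) :
    ∀ r ∈ (samplePass P H idx R B).support,
      r.1 ⊂ R ∧ B ⊆ r.2 ∧ (R ⊆ H.verts → r.2.Nonempty) := by
  intro r hr
  simp only [samplePass, prune, PMF.mem_support_bind_iff, PMF.support_pure,
    Set.mem_singleton_iff] at hr
  obtain ⟨q, hq, R', ⟨e, -, e', -, hR'⟩, rfl⟩ := hr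
  obtain ⟨v, hv⟩ := hR
  have h := sampleBuckets_support P H idx _ R B q hq
  have h' := h.2.2 ⟨v, hv, Nat.lt_succ_of_le (Finset.le_sup (Finset.mem_univ v))⟩
  refine ⟨lt_of_le_of_lt ?_ h'.1, h.2.1, h'.2⟩
  rw [hR']
  exact Finset.filter_subset _ _

/-- Sampling and pruning, repeated until all buckets are empty. Returns the batch. -/
def batchLoop (P : Params V) (H : DAG V) (idx : V → ℕ) (R B : Finset V) : PMF (Finset V) :=
  if _h : R.Nonempty then
    (samplePass P H idx R B).bindOnSupport fun r _hr => batchLoop P H idx r.1 r.2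
  else PMF.pure B
termination_by R.card
decreasing_by exact Finset.card_lt_card (samplePass_support P H idx R B _h r _hr).1

/-- `FindBatch`: estimate, put all vertices into buckets according to the estimated number of
ancestor edges, and sample and prune until all buckets are empty. -/
def findBatch (P : Params V) (H : DAG V) : PMF (Finset V) :=
  (estimates P H).bind fun e => batchLoop P H (fun v => bucketIndex (e.2 v)) H.verts ∅

theorem batchLoop_support (P : Params V) (H : DAG V) (idx : V → ℕ) :
    ∀ (n : ℕ) (R B : Finset V), R.card = n →
      ∀ B' ∈ (batchLoop P H idx R B).support, B ⊆ B' ∧ (R.Nonempty → R ⊆ H.verts → B'.Nonempty) := by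
  intro n
  induction n using Nat.strong_induction_on with
  | _ n ih =>
    intro R B hR B' hB'
    rw [batchLoop] at hB'
    split_ifs at hB' with h
    · rw [PMF.mem_support_bindOnSupport_iff] at hB'
      obtain ⟨r, hr, hB'⟩ := hB'
      have h1 := samplePass_support P H idx R B h r hr
      have h2 := ih _ (hR ▸ Finset.card_lt_card h1.1) r.1 r.2 rfl B' hB'
      exact ⟨h1.2.1.trans h2.1, fun _ hRV => (h1.2.2 hRV).mono h2.1⟩
    · rw [PMF.support_pure, Set.mem_singleton_iff] at hB'
      subst hB'
      exact ⟨subset_rfl, fun h' => absurd h' h⟩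

/-- The vertices found by the algorithm stay within `H`. -/
theorem sampleBucket_subset (P : Params V) (H : DAG V) (idx : V → ℕ) (i : ℕ) :
    ∀ (n : ℕ) (R B : Finset V) (s : ℕ), R.card = n → R ⊆ H.verts → B ⊆ H.verts →
      ∀ r ∈ (sampleBucket P H idx i R B s).support, r.2 ⊆ H.verts := by
  intro n
  induction n using Nat.strong_induction_on with
  | _ n ih =>
    intro R B s hR hRV hBV r hr
    rw [sampleBucket] at hr
    split_ifs at hr with h
    · rw [PMF.mem_support_bindOnSupport_iff] at hr
      obtain ⟨v, hv, hr⟩ := hr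
      have hvR : v ∈ R :=
        (Finset.mem_filter.1 ((PMF.mem_support_uniformOfFinset_iff _ _).1 hv)).1
      have hc : (R.erase v).card < n := hR ▸ Finset.card_erase_lt_of_mem hvR
      have hs : R.erase v ⊆ H.verts := (Finset.erase_subset _ _).trans hRV
      split_ifs at hr with hf
      · exact ih _ hc _ _ _ rfl hs (Finset.insert_subset (hRV hvR) hBV) r hr
      · exact ih _ hc _ _ _ rfl hs hBV r hr
    · rw [PMF.support_pure, Set.mem_singleton_iff] at hr
      subst hr
      exact hBV

theorem sampleBuckets_subset (P : Params V) (H : DAG V) (idx : V → ℕ) :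
    ∀ (j : ℕ) (R B : Finset V), R ⊆ H.verts → B ⊆ H.verts →
      ∀ r ∈ (sampleBuckets P H idx j R B).support, r.2 ⊆ H.verts := by
  intro j
  induction j with
  | zero =>
    intro R B _ hB r hr
    rw [sampleBuckets, PMF.support_pure, Set.mem_singleton_iff] at hr
    subst hr
    exact hB
  | succ j ih =>
    intro R B hR hB r hr
    rw [sampleBuckets, PMF.mem_support_bind_iff] at hr
    obtain ⟨q, hq, hr⟩ := hr
    exact ih _ _ ((sampleBucket_support P H idx j _ _ _ _ rfl q hq).1.trans hR)
      (sampleBucket_subset P H idx j _ _ _ _ rfl hR hB q hq) r hr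

theorem batchLoop_subset (P : Params V) (H : DAG V) (idx : V → ℕ) :
    ∀ (n : ℕ) (R B : Finset V), R.card = n → R ⊆ H.verts → B ⊆ H.verts →
      ∀ B' ∈ (batchLoop P H idx R B).support, B' ⊆ H.verts := by
  intro n
  induction n using Nat.strong_induction_on with
  | _ n ih =>
    intro R B hR hRV hBV B' hB'
    rw [batchLoop] at hB'
    split_ifs at hB' with h
    · rw [PMF.mem_support_bindOnSupport_iff] at hB'
      obtain ⟨r, hr, hB'⟩ := hB'
      have h1 := (samplePass_support P H idx R B h r hr).1
      have h3 : r.2 ⊆ H.verts := by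
        simp only [samplePass, PMF.mem_support_bind_iff, PMF.support_pure,
          Set.mem_singleton_iff] at hr
        obtain ⟨q, hq, R', -, rfl⟩ := hr
        exact sampleBuckets_subset P H idx _ R B hRV hBV q hq
      exact ih _ (hR ▸ Finset.card_lt_card h1) r.1 r.2 rfl (h1.1.trans hRV) h3 B' hB'
    · rw [PMF.support_pure, Set.mem_singleton_iff] at hB'
      subst hB'
      exact hBV

theorem findBatch_progress (P : Params V) (H : DAG V) (hH : H.verts.Nonempty) :
    ∀ B ∈ (findBatch P H).support, (H.remove (H.ancSet B)).verts.card < H.verts.card := by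
  intro B hB
  rw [findBatch, PMF.mem_support_bind_iff] at hB
  obtain ⟨e, -, hB⟩ := hB
  obtain ⟨v, hv⟩ := (batchLoop_support P H _ _ _ _ rfl B hB).2 hH subset_rfl
  have hvH : v ∈ H.verts :=
    batchLoop_subset P H _ _ _ _ rfl subset_rfl (Finset.empty_subset _) B hB hv
  have hvA : v ∈ H.ancSet B := Finset.mem_biUnion.2 ⟨v, hv, H.self_mem_anc hvH⟩
  exact Finset.card_lt_card (Finset.ssubset_iff_subset_ne.2
    ⟨Finset.sdiff_subset, fun h => (Finset.mem_sdiff.1 (h ▸ hvH)).2 hvA⟩)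

/-- `ScheduleSmallSubgraph`: as long as vertices of `H` are left, find a batch `B`, schedule the
ancestor sets of its elements, and remove all scheduled vertices (the ancestors of `B`) from `H`.
The result is the random sequence of batches. The placement of a batch on the machines and the
communication delay after it have no influence on this sequence. -/
def scheduleSmallSubgraph (P : Params V) (H : DAG V) : PMF (List (Finset V)) :=
  if _h : H.verts.Nonempty then
    (findBatch P H).bindOnSupport fun B _hB =>
      (scheduleSmallSubgraph P (H.remove (H.ancSet B))).bind fun L => PMF.pure (B :: L)
  else PMF.pure []
termination_by H.verts.card
decreasing_by exact findBatch_progress P H _h B _hB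

end

end BatchScheduling

namespace BatchScheduling

open scoped Classical ENNReal

/-! ### Pairwise independent hashing -/

section Hashing

variable {U : Type*} {M : ℕ}

/-! The argument separates a probabilistic part, that all estimates made during pruning are
accurate, from a deterministic bound on the number of batches when they are.

Accuracy: Chebyshev's inequality and a collision bound show that one hash function gives an estimate
with relative error above 1/3 with probability at most 3/16. The median of `k` of them fails with
probability at most `(25/32)^k` (`HashFamily.card_estimate_not_accurate_le`). With `n` vertices
there are at most `n` batches, at most `n` prunings per batch, two graphs per pruning and `2n`
estimates per graph. The union bound `4n³(25/32)^k` is at most `n^(-d)` once `c'` is large in terms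
of `d`.

Reduction: put `δ = 4γ`. A vertex leaves the buckets only by joining the batch, by being stale, or
by being pruned. In each case at most a `δ`-fraction of its ancestors or of its (nonempty) set of
ancestor edges remains; for pruning this needs accurate estimates. Hence every vertex is reduced by
every batch (`IsGoodBatch`).

Counting: follow a vertex that is still present when the last of `T` batches begins. It has at most
`X = 2ρ` ancestors and, by acyclicity, at most `X²/2` ancestor edges. With `L = log_{1/δ} X`, fewer
than `L` reductions of the first number and fewer than `2L` of the second can happen while an edge
remains. An edge does remain after `T - 2` batches, so `T < 3L + 2`. This gives `T ≤ 4L` if `L ≥ 2`;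
for smaller `L` the integrality of the exponents leaves only `T = 5` as a possible counterexample
above the bound 3, and `Shrinking.one_le_of_three` excludes it. -/

theorem HashFamily.card_seed_pos (F : HashFamily U M) : (0 : ℝ) < Fintype.card F.Seed := by
  exact_mod_cast Fintype.card_pos

theorem HashFamily.card_pair_mul (F : HashFamily U M) {x y : U} (hxy : x ≠ y)
    (A : Finset (Fin M × Fin M)) :
    (Finset.univ.filter fun s : F.Seed => (F.hash s x, F.hash s y) ∈ A).card * M ^ 2 =
      A.card * Fintype.card F.Seed := by
  have h : (Finset.univ.filter fun s : F.Seed => (F.hash s x, F.hash s y) ∈ A).card =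
      ∑ p ∈ A, (Finset.univ.filter fun s : F.Seed => F.hash s x = p.1 ∧ F.hash s y = p.2).card := by
    rw [Finset.card_eq_sum_card_fiberwise (f := fun s => (F.hash s x, F.hash s y)) (t := A)]
    · refine Finset.sum_congr rfl fun p hp => ?_
      congr 1
      ext s
      simp only [Finset.mem_filter, Finset.mem_univ, true_and, Prod.ext_iff]
      constructor
      · exact fun h => h.2
      · intro h
        refine ⟨?_, h⟩
        rw [h.1, h.2]
        exact hp
    · intro s hs
      simpa using hs
  rw [h, Finset.sum_mul, Finset.sum_congr rfl fun p _ => F.two_universal x y hxy p.1 p.2]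
  simp

/-- Uniformity of one hash value is a marginal of the pair law, so a second element of `U` must
exist. -/
theorem HashFamily.card_single_mul (F : HashFamily U M) [Nontrivial U] (x : U)
    (A : Finset (Fin M)) (hM : 0 < M) :
    (Finset.univ.filter fun s : F.Seed => F.hash s x ∈ A).card * M =
      A.card * Fintype.card F.Seed := by
  obtain ⟨y, hy⟩ := exists_ne x
  have h := F.card_pair_mul hy.symm (A ×ˢ Finset.univ)
  simp only [Finset.mem_product, Finset.mem_univ, and_true, Finset.card_product,
    Finset.card_univ, Fintype.card_fin] at h
  have : M * ((Finset.univ.filter fun s : F.Seed => F.hash s x ∈ A).card * M) =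
      M * (A.card * Fintype.card F.Seed) := by
    rw [← mul_assoc, mul_comm M, mul_assoc, ← sq, h]; ring
  exact Nat.eq_of_mul_eq_mul_left hM this

/-- The number of elements of `S` whose hash value (counted from `1`) is at most `q`. -/
def hitCount (h : U → Fin M) (S : Finset U) (q : ℕ) : ℕ :=
  (S.filter fun x => (h x : ℕ) + 1 ≤ q).card

theorem card_fin_lt {q : ℕ} (hq : q ≤ M) :
    (Finset.univ.filter fun a : Fin M => (a : ℕ) + 1 ≤ q).card = q := by
  simp only [Nat.add_one_le_iff]
  rw [Fin.card_filter_val_lt]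
  exact min_eq_right hq

theorem hitCount_eq_sum (h : U → Fin M) (S : Finset U) (q : ℕ) :
    (hitCount h S q : ℝ) = ∑ x ∈ S, if (h x : ℕ) + 1 ≤ q then (1 : ℝ) else 0 := by
  rw [hitCount, Finset.card_filter]
  push_cast
  rfl

theorem HashFamily.sum_indicator (F : HashFamily U M) [Nontrivial U] (hM : 0 < M) {q : ℕ}
    (hq : q ≤ M) (x : U) :
    ∑ s : F.Seed, (if (F.hash s x : ℕ) + 1 ≤ q then (1 : ℝ) else 0) =
      q / M * Fintype.card F.Seed := by
  have h := F.card_single_mul x (Finset.univ.filter fun a : Fin M => (a : ℕ) + 1 ≤ q) hM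
  rw [card_fin_lt hq] at h
  simp only [Finset.mem_filter, Finset.mem_univ, true_and] at h
  rw [Finset.sum_boole]
  have hM' : (M : ℝ) ≠ 0 := by positivity
  field_simp
  exact_mod_cast h

theorem HashFamily.sum_indicator_mul (F : HashFamily U M) (hM : 0 < M) {q : ℕ}
    (hq : q ≤ M) {x y : U} (hxy : x ≠ y) :
    ∑ s : F.Seed, ((if (F.hash s x : ℕ) + 1 ≤ q then (1 : ℝ) else 0) *
      (if (F.hash s y : ℕ) + 1 ≤ q then (1 : ℝ) else 0)) =
      (q / M) ^ 2 * Fintype.card F.Seed := by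
  have h := F.card_pair_mul hxy ((Finset.univ.filter fun a : Fin M => (a : ℕ) + 1 ≤ q) ×ˢ
    (Finset.univ.filter fun a : Fin M => (a : ℕ) + 1 ≤ q))
  rw [Finset.card_product, card_fin_lt hq] at h
  simp only [Finset.mem_product, Finset.mem_filter, Finset.mem_univ, true_and] at h
  have h2 : ∀ s : F.Seed, ((if (F.hash s x : ℕ) + 1 ≤ q then (1 : ℝ) else 0) *
      (if (F.hash s y : ℕ) + 1 ≤ q then (1 : ℝ) else 0)) =
      if (F.hash s x : ℕ) + 1 ≤ q ∧ (F.hash s y : ℕ) + 1 ≤ q then (1 : ℝ) else 0 := by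
    intro s
    split_ifs <;> simp_all
  rw [Finset.sum_congr rfl fun s _ => h2 s, Finset.sum_boole]
  have hM' : (M : ℝ) ≠ 0 := by positivity
  field_simp
  have h3 : ((Finset.univ.filter fun s : F.Seed => (F.hash s x : ℕ) + 1 ≤ q ∧
    (F.hash s y : ℕ) + 1 ≤ q).card : ℝ) * (M : ℝ) ^ 2 = q * q * Fintype.card F.Seed := by
    exact_mod_cast h
  rw [h3]; ring

theorem HashFamily.sum_hitCount (F : HashFamily U M) [Nontrivial U] (hM : 0 < M) {q : ℕ}
    (hq : q ≤ M) (S : Finset U) :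
    ∑ s : F.Seed, (hitCount (F.hash s) S q : ℝ) =
      S.card * q / M * Fintype.card F.Seed := by
  simp_rw [hitCount_eq_sum]
  rw [Finset.sum_comm, Finset.sum_congr rfl fun x _ => F.sum_indicator hM hq x]
  simp
  ring

/-- Expanding the square, pairwise independence bounds the off-diagonal terms by the squared mean
and the diagonal adds at most the mean. So the variance is at most the mean. -/
theorem HashFamily.sum_hitCount_sq_le (F : HashFamily U M) [Nontrivial U] (hM : 0 < M) {q : ℕ}
    (hq : q ≤ M) (S : Finset U) :
    ∑ s : F.Seed, (hitCount (F.hash s) S q : ℝ) ^ 2 ≤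
      ((S.card * q / M : ℝ) ^ 2 + S.card * q / M) * Fintype.card F.Seed := by
  simp_rw [hitCount_eq_sum, sq (∑ x ∈ S, _), Finset.sum_mul_sum]
  rw [Finset.sum_comm]
  have hx : ∀ x ∈ S, ∑ s : F.Seed, ∑ y ∈ S, ((if (F.hash s x : ℕ) + 1 ≤ q then (1 : ℝ) else 0) *
      (if (F.hash s y : ℕ) + 1 ≤ q then (1 : ℝ) else 0)) ≤
      (S.card * (q / M) ^ 2 + q / M) * Fintype.card F.Seed := by
    intro x hx
    rw [Finset.sum_comm]
    have hy : ∀ y ∈ S, ∑ s : F.Seed, ((if (F.hash s x : ℕ) + 1 ≤ q then (1 : ℝ) else 0) *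
        (if (F.hash s y : ℕ) + 1 ≤ q then (1 : ℝ) else 0)) ≤
        ((q / M) ^ 2 + if x = y then (q / M : ℝ) else 0) * Fintype.card F.Seed := by
      intro y _
      split_ifs with hxy
      · subst hxy
        have : ∀ s : F.Seed, ((if (F.hash s x : ℕ) + 1 ≤ q then (1 : ℝ) else 0) *
          (if (F.hash s x : ℕ) + 1 ≤ q then (1 : ℝ) else 0)) =
          (if (F.hash s x : ℕ) + 1 ≤ q then (1 : ℝ) else 0) := by
          intro s; split_ifs <;> simp
        rw [Finset.sum_congr rfl fun s _ => this s, F.sum_indicator hM hq x]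
        gcongr
        exact le_add_of_nonneg_left (by positivity)
      · rw [F.sum_indicator_mul hM hq hxy, add_zero]
    refine (Finset.sum_le_sum hy).trans (le_of_eq ?_)
    rw [← Finset.sum_mul, Finset.sum_add_distrib]
    simp [hx]
  refine (Finset.sum_le_sum hx).trans (le_of_eq ?_)
  simp
  ring

/-- Chebyshev's inequality for the number of small hash values. -/
theorem HashFamily.card_deviation_le (F : HashFamily U M) [Nontrivial U] (hM : 0 < M) {q : ℕ}
    (hq : q ≤ M) (S : Finset U) {r : ℝ} (hr : 0 ≤ r) :
    ((Finset.univ.filter fun s : F.Seed =>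
      r ≤ |(hitCount (F.hash s) S q : ℝ) - S.card * q / M|).card : ℝ) * r ^ 2 ≤
      S.card * q / M * Fintype.card F.Seed := by
  set μ : ℝ := S.card * q / M with hμ
  have h1 : ∑ s : F.Seed, ((hitCount (F.hash s) S q : ℝ) - μ) ^ 2 ≤ μ * Fintype.card F.Seed := by
    have h2 : ∀ s : F.Seed, ((hitCount (F.hash s) S q : ℝ) - μ) ^ 2 =
        (hitCount (F.hash s) S q : ℝ) ^ 2 - 2 * μ * (hitCount (F.hash s) S q : ℝ) + μ ^ 2 := by
      intro s; ring
    rw [Finset.sum_congr rfl fun s _ => h2 s, Finset.sum_add_distrib, Finset.sum_sub_distrib,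
      ← Finset.mul_sum, F.sum_hitCount hM hq S]
    have h3 := F.sum_hitCount_sq_le hM hq S
    rw [← hμ] at h3 ⊢
    simp only [Finset.sum_const, Finset.card_univ, nsmul_eq_mul]
    nlinarith
  refine le_trans ?_ h1
  rw [← nsmul_eq_mul]
  refine (Finset.card_nsmul_le_sum _ (fun s : F.Seed => ((hitCount (F.hash s) S q : ℝ) - μ) ^ 2) _
    fun s hs => ?_).trans (Finset.sum_le_sum_of_subset_of_nonneg (Finset.filter_subset _ _)
      fun s _ _ => sq_nonneg _)
  rw [← sq_abs ((hitCount (F.hash s) S q : ℝ) - μ)]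
  exact pow_le_pow_left₀ hr (Finset.mem_filter.1 hs).2 2

/-- The probability of a collision is at most `|S| (|S| - 1) / 2M`. -/
theorem HashFamily.card_collision_le (F : HashFamily U M) (hM : 0 < M) (S : Finset U) :
    (Finset.univ.filter fun s : F.Seed => ¬ Set.InjOn (F.hash s) S).card * (2 * M) ≤
      S.card * (S.card - 1) * Fintype.card F.Seed := by
  have hpair : ∀ p ∈ S.offDiag,
      (Finset.univ.filter fun s : F.Seed => F.hash s p.1 = F.hash s p.2).card * M =
        Fintype.card F.Seed := by
    intro p hp
    have h := F.card_pair_mul (Finset.mem_offDiag.1 hp).2.2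
      (Finset.univ.image fun a : Fin M => (a, a))
    rw [Finset.card_image_of_injective _ fun a b h => (Prod.ext_iff.1 h).1] at h
    simp only [Finset.mem_image, Finset.mem_univ, true_and, Prod.mk.injEq, exists_eq_left,
      Finset.card_univ, Fintype.card_fin] at h
    refine Nat.eq_of_mul_eq_mul_left hM ?_
    rw [← h]; ring
  have hcount : (Finset.univ.filter fun s : F.Seed => ¬ Set.InjOn (F.hash s) S).card * 2 ≤
      ∑ p ∈ S.offDiag,
        (Finset.univ.filter fun s : F.Seed => F.hash s p.1 = F.hash s p.2).card := by
    simp_rw [Finset.card_filter]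
    rw [Finset.sum_comm, Finset.sum_mul]
    refine Finset.sum_le_sum fun s _ => ?_
    split_ifs with hs
    · simp
    · rw [Set.InjOn] at hs
      push Not at hs
      obtain ⟨x, hx, y, hy, hxy, hne⟩ := hs
      rw [← Finset.card_filter]
      -- Each collision is seen in both orders, which is the source of the factor 2.
      have h2 : ({(x, y), (y, x)} : Finset (U × U)) ⊆
          S.offDiag.filter fun p => F.hash s p.1 = F.hash s p.2 := by
        intro p hp
        simp only [Finset.mem_insert, Finset.mem_singleton] at hp
        rcases hp with rfl | rfl
        · exact Finset.mem_filter.2 ⟨Finset.mem_offDiag.2 ⟨hx, hy, hne⟩, hxy⟩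
        · exact Finset.mem_filter.2 ⟨Finset.mem_offDiag.2 ⟨hy, hx, hne.symm⟩, hxy.symm⟩
      have h3 : ({(x, y), (y, x)} : Finset (U × U)).card = 2 := by
        rw [Finset.card_pair]
        intro h
        exact hne (Prod.ext_iff.1 h).1
      calc 1 * 2 = _ := h3.symm
        _ ≤ _ := Finset.card_le_card h2
  calc _ = (Finset.univ.filter fun s : F.Seed => ¬ Set.InjOn (F.hash s) S).card * 2 * M := by ring
    _ ≤ _ := Nat.mul_le_mul_right M hcount
    _ = _ := by
      rw [Finset.sum_mul, Finset.sum_congr rfl hpair, Finset.sum_const, Finset.offDiag_card,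
        smul_eq_mul, Nat.mul_sub_one]

end Hashing

/-! ### The single estimates -/

section SingleEstimate

variable {U : Type*} {M : ℕ}

/-- The hash values, counted from `1`, of the elements of `S`. -/
def hashValues (h : U → Fin M) (S : Finset U) : Finset ℕ := S.image fun x => (h x : ℕ) + 1

theorem length_smallestValues (t : ℕ) (h : U → Fin M) (S : Finset U) :
    (smallestValues t h S).length = min t (hashValues h S).card := by
  rw [smallestValues, List.length_take, Finset.length_sort, hashValues]

theorem card_hashValues_le (h : U → Fin M) (S : Finset U) : (hashValues h S).card ≤ S.card :=
  Finset.card_image_le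

theorem card_hashValues_of_injOn {h : U → Fin M} {S : Finset U} (hS : Set.InjOn h S) :
    (hashValues h S).card = S.card := by
  refine Finset.card_image_of_injOn fun x hx y hy hxy => hS hx hy ?_
  exact Fin.ext (by simpa using hxy)

theorem card_hashValues_filter_le (h : U → Fin M) (S : Finset U) (q : ℕ) :
    ((hashValues h S).filter (· ≤ q)).card ≤ hitCount h S q := by
  rw [hashValues, Finset.filter_image]
  exact Finset.card_image_le

theorem hitCount_of_injOn {h : U → Fin M} {S : Finset U} (hS : Set.InjOn h S) (q : ℕ) :
    hitCount h S q = ((hashValues h S).filter (· ≤ q)).card := by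
  rw [hashValues, Finset.filter_image, hitCount]
  refine (Finset.card_image_of_injOn fun x hx y hy hxy => hS ?_ ?_ ?_).symm
  · exact (Finset.mem_filter.1 hx).1
  · exact (Finset.mem_filter.1 hy).1
  · exact Fin.ext (by simpa using hxy)

/-- The last of the `t` smallest hash values, if there are that many. -/
theorem getLastD_smallestValues {t : ℕ} (ht : 0 < t) {h : U → Fin M} {S : Finset U}
    (hS : t ≤ (hashValues h S).card) :
    (smallestValues t h S).getLastD 1 ∈ hashValues h S ∧
      t ≤ ((hashValues h S).filter (· ≤ (smallestValues t h S).getLastD 1)).card ∧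
      ((hashValues h S).filter (· < (smallestValues t h S).getLastD 1)).card < t := by
  have hlen : (smallestValues t h S).length = t := by
    rw [length_smallestValues, min_eq_left hS]
  have hsorted := (Finset.sortedLT_sort (hashValues h S)).pairwise
  have hmem : ∀ y, y ∈ hashValues h S ↔ y ∈ (hashValues h S).sort (· ≤ ·) := fun y =>
    (Finset.mem_sort _).symm
  have hl : smallestValues t h S = ((hashValues h S).sort (· ≤ ·)).take t := rfl
  set L := (hashValues h S).sort (· ≤ ·) with hL
  set l := smallestValues t h S with hl'
  have hne : l ≠ [] := by
    intro h0
    rw [h0] at hlen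
    simp at hlen
    omega
  have hlast : l.getLastD 1 = l.getLast hne := by
    rw [List.getLastD_eq_getLast?, List.getLast?_eq_some_getLast hne]
    rfl
  have hlp : l.Pairwise (· < ·) := by
    rw [hl]
    exact hsorted.sublist (List.take_sublist _ _)
  have hle : ∀ y ∈ l, y ≤ l.getLast hne := by
    intro y hy
    rw [← List.dropLast_append_getLast hne, List.pairwise_append] at hlp
    rw [← List.dropLast_append_getLast hne, List.mem_append] at hy
    rcases hy with hy | hy
    · exact (hlp.2.2 y hy _ (List.mem_singleton_self _)).le
    · exact (List.mem_singleton.1 hy).le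
  have hgt : ∀ y ∈ L, y < l.getLast hne → y ∈ l := by
    intro y hy hlt
    rw [← List.take_append_drop t L, List.pairwise_append] at hsorted
    rw [← List.take_append_drop t L, List.mem_append] at hy
    rcases hy with hy | hy
    · exact hl ▸ hy
    · have := hsorted.2.2 (l.getLast hne) (hl ▸ List.getLast_mem hne) y hy
      omega
  have hcard : l.toFinset.card = t := by
    rw [List.toFinset_card_of_nodup (hlp.imp fun h => h.ne), hlen]
  have hsub : ∀ y ∈ l, y ∈ L := fun y hy => List.mem_of_mem_take (hl ▸ hy)
  rw [hlast]
  refine ⟨(hmem _).2 (hsub _ (List.getLast_mem hne)), ?_, ?_⟩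
  · rw [← hcard]
    refine Finset.card_le_card fun y hy => ?_
    rw [List.mem_toFinset] at hy
    exact Finset.mem_filter.2 ⟨(hmem _).2 (hsub y hy), hle y hy⟩
  · have : (hashValues h S).filter (· < l.getLast hne) ⊆ l.toFinset.erase (l.getLast hne) := by
      intro y hy
      rw [Finset.mem_filter] at hy
      exact Finset.mem_erase.2 ⟨hy.2.ne, List.mem_toFinset.2 (hgt y ((hmem y).1 hy.1) hy.2)⟩
    refine (Finset.card_le_card this).trans_lt ?_
    rw [Finset.card_erase_of_mem (List.mem_toFinset.2 (List.getLast_mem hne)), hcard]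
    omega

/-- An estimate is accurate if its relative error is at most `1/3`. -/
def Accurate (m : ℕ) (x : ℝ) : Prop := 2 / 3 * (m : ℝ) ≤ x ∧ x ≤ 4 / 3 * (m : ℝ)

theorem singleEstimate_of_lt {t : ℕ} {h : U → Fin M} {S : Finset U}
    (hS : (hashValues h S).card < t) : singleEstimate t h S = (hashValues h S).card := by
  rw [singleEstimate, length_smallestValues, min_eq_right hS.le, if_pos hS]

theorem singleEstimate_of_le {t : ℕ} {h : U → Fin M} {S : Finset U}
    (hS : t ≤ (hashValues h S).card) :
    singleEstimate t h S = t * M / ((smallestValues t h S).getLastD 1 : ℕ) := by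
  rw [singleEstimate, length_smallestValues, min_eq_left hS, if_neg (lt_irrefl t)]

theorem hashValues_bounds {h : U → Fin M} {S : Finset U} {y : ℕ} (hy : y ∈ hashValues h S) :
    1 ≤ y ∧ y ≤ M := by
  obtain ⟨x, -, rfl⟩ := Finset.mem_image.1 hy
  exact ⟨Nat.le_add_left _ _, (h x).2⟩

/-- An overestimate means that the `t`-th smallest value lies below 3/4 of its expected position
`tM/|S|`. Collisions do no harm here, since they only lower the number of distinct values. -/
theorem le_hitCount_of_singleEstimate_gt {t : ℕ} (ht : 0 < t) {h : U → Fin M} {S : Finset U}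
    (hS : 4 / 3 * (S.card : ℝ) < singleEstimate t h S) :
    t ≤ S.card ∧ t ≤ hitCount h S ⌊(3 * t * M / (4 * S.card) : ℝ)⌋₊ := by
  rcases lt_or_ge (hashValues h S).card t with hlt | hle
  · rw [singleEstimate_of_lt hlt] at hS
    have : ((hashValues h S).card : ℝ) ≤ S.card := by exact_mod_cast card_hashValues_le h S
    have : (0 : ℝ) ≤ S.card := by positivity
    linarith
  · have hm : t ≤ S.card := hle.trans (card_hashValues_le h S)
    refine ⟨hm, ?_⟩
    rw [singleEstimate_of_le hle] at hS
    obtain ⟨h1, h2, -⟩ := getLastD_smallestValues ht hle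
    set ℓ := (smallestValues t h S).getLastD 1
    have hℓ : (0 : ℝ) < ℓ := by exact_mod_cast (hashValues_bounds h1).1
    have hm0 : (0 : ℝ) < S.card := by exact_mod_cast ht.trans_le hm
    rw [lt_div_iff₀ hℓ] at hS
    have hℓq : ℓ ≤ ⌊(3 * t * M / (4 * S.card) : ℝ)⌋₊ := by
      refine Nat.le_floor ?_
      rw [le_div_iff₀ (by positivity)]
      linarith
    refine h2.trans (le_trans (Finset.card_le_card ?_) (card_hashValues_filter_le h S _))
    exact Finset.monotone_filter_right _ fun y _ hy => hy.trans hℓq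

/-- An underestimate means that the `t`-th smallest value lies above 3/2 of its expected position.
Injectivity is needed to pass from few distinct values to few elements. The threshold is at most `M`
because it lies below an actual hash value. -/
theorem hitCount_lt_of_singleEstimate_lt {t : ℕ} (ht : 0 < t) {h : U → Fin M} {S : Finset U}
    (hinj : Set.InjOn h S) (hS : singleEstimate t h S < 2 / 3 * (S.card : ℝ)) :
    t ≤ S.card ∧ ⌊(3 * t * M / (2 * S.card) : ℝ)⌋₊ ≤ M ∧
      hitCount h S ⌊(3 * t * M / (2 * S.card) : ℝ)⌋₊ < t := by
  have hcard := card_hashValues_of_injOn hinj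
  rcases lt_or_ge (hashValues h S).card t with hlt | hle
  · rw [singleEstimate_of_lt hlt, hcard] at hS
    have : (0 : ℝ) ≤ S.card := by positivity
    linarith
  · have hm : t ≤ S.card := hcard ▸ hle
    refine ⟨hm, ?_⟩
    rw [singleEstimate_of_le hle] at hS
    obtain ⟨h1, -, h3⟩ := getLastD_smallestValues ht hle
    set ℓ := (smallestValues t h S).getLastD 1
    have hℓ : (0 : ℝ) < ℓ := by exact_mod_cast (hashValues_bounds h1).1
    have hm0 : (0 : ℝ) < S.card := by exact_mod_cast ht.trans_le hm
    rw [div_lt_iff₀ hℓ] at hS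
    have hℓq : ⌊(3 * t * M / (2 * S.card) : ℝ)⌋₊ < ℓ := by
      rw [Nat.floor_lt (by positivity), div_lt_iff₀ (by positivity)]
      linarith
    refine ⟨hℓq.le.trans (hashValues_bounds h1).2, ?_⟩
    rw [hitCount_of_injOn hinj]
    refine lt_of_le_of_lt (Finset.card_le_card ?_) h3
    exact Finset.monotone_filter_right _ fun y _ hy => lt_of_le_of_lt hy hℓq

/-- At the threshold the mean number of hits is at most `3t/4`, but an overestimate needs `t`.
Chebyshev with deviation `t/4` gives `(3t/4)/(t/4)² = 12/t`. -/
theorem HashFamily.card_singleEstimate_gt_le (F : HashFamily U M) [Nontrivial U] (hM : 0 < M)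
    {t : ℕ} (ht : 0 < t) (S : Finset U) :
    ((Finset.univ.filter fun s : F.Seed =>
      4 / 3 * (S.card : ℝ) < singleEstimate t (F.hash s) S).card : ℝ) * t ≤
      12 * Fintype.card F.Seed := by
  rcases lt_or_ge S.card t with hlt | hle
  · rw [Finset.filter_false_of_mem]
    · simp
    · intro s _ hs
      exact absurd (le_hitCount_of_singleEstimate_gt ht hs).1 (not_le.2 hlt)
  · set q := ⌊(3 * t * M / (4 * S.card) : ℝ)⌋₊ with hq
    have hm0 : (0 : ℝ) < S.card := by exact_mod_cast ht.trans_le hle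
    have hM0 : (0 : ℝ) < M := by exact_mod_cast hM
    have ht0 : (0 : ℝ) < t := by exact_mod_cast ht
    have htm : (t : ℝ) ≤ S.card := by exact_mod_cast hle
    have hqr : (q : ℝ) ≤ 3 * t * M / (4 * S.card) := Nat.floor_le (by positivity)
    have hqM : q ≤ M := by
      have : (q : ℝ) ≤ M := hqr.trans (by rw [div_le_iff₀ (by positivity)]; nlinarith)
      exact_mod_cast this
    have hμ : (S.card * q / M : ℝ) ≤ 3 / 4 * t := by
      rw [div_le_iff₀ hM0]
      rw [le_div_iff₀ (by positivity)] at hqr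
      linarith
    have h := F.card_deviation_le hM hqM S (r := t / 4) (by positivity)
    have hsub : ((Finset.univ.filter fun s : F.Seed =>
        4 / 3 * (S.card : ℝ) < singleEstimate t (F.hash s) S).card : ℝ) ≤
        (Finset.univ.filter fun s : F.Seed =>
          (t / 4 : ℝ) ≤ |(hitCount (F.hash s) S q : ℝ) - S.card * q / M|).card := by
      refine Nat.cast_le.2 (Finset.card_le_card (Finset.monotone_filter_right _ fun s _ hs => ?_))
      have h1 : (t : ℝ) ≤ hitCount (F.hash s) S q :=
        Nat.cast_le.2 (le_hitCount_of_singleEstimate_gt ht hs).2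
      exact le_trans (by linarith) (le_abs_self _)
    have hW := F.card_seed_pos
    have h2 : ((Finset.univ.filter fun s : F.Seed =>
        4 / 3 * (S.card : ℝ) < singleEstimate t (F.hash s) S).card : ℝ) * (t / 4) ^ 2 ≤
        3 / 4 * t * Fintype.card F.Seed :=
      (mul_le_mul_of_nonneg_right hsub (by positivity)).trans
        (h.trans (mul_le_mul_of_nonneg_right hμ hW.le))
    refine le_of_mul_le_mul_right ?_ ht0
    nlinarith

/-- The mean number of hits is about `3t/2`, but an underestimate leaves fewer than `t`. Chebyshev
with deviation `t/4` gives `(3t/2)/(t/4)² = 24/t`. -/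
theorem HashFamily.card_singleEstimate_lt_le (F : HashFamily U M) [Nontrivial U]
    {t : ℕ} (ht : 4 ≤ t) (S : Finset U) (hM : S.card ≤ M) :
    ((Finset.univ.filter fun s : F.Seed => Set.InjOn (F.hash s) S ∧
      singleEstimate t (F.hash s) S < 2 / 3 * (S.card : ℝ)).card : ℝ) * t ≤
      24 * Fintype.card F.Seed := by
  have ht' : 0 < t := by omega
  set q := ⌊(3 * t * M / (2 * S.card) : ℝ)⌋₊ with hq
  by_cases hcond : t ≤ S.card ∧ q ≤ M
  · obtain ⟨hle, hqM⟩ := hcond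
    have hm0 : (0 : ℝ) < S.card := by exact_mod_cast ht'.trans_le hle
    have hM1 : (S.card : ℝ) ≤ M := by exact_mod_cast hM
    have hM0 : (0 : ℝ) < M := hm0.trans_le hM1
    have ht0 : (4 : ℝ) ≤ t := by exact_mod_cast ht
    have hqr : (q : ℝ) ≤ 3 * t * M / (2 * S.card) := Nat.floor_le (by positivity)
    have hqr' : 3 * t * M / (2 * S.card) < (q : ℝ) + 1 := Nat.lt_floor_add_one _
    have hμ : (S.card * q / M : ℝ) ≤ 3 / 2 * t := by
      rw [div_le_iff₀ hM0]
      rw [le_div_iff₀ (by positivity)] at hqr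
      linarith
    -- Rounding the threshold down costs at most `|S|/M ≤ 1` in the mean; `4 ≤ t` then still leaves
    -- a gap of `t/4`.
    have hμ' : 3 / 2 * t - 1 ≤ (S.card * q / M : ℝ) := by
      rw [le_div_iff₀ hM0]
      rw [div_lt_iff₀ (by positivity)] at hqr'
      linarith
    have h := F.card_deviation_le (by exact_mod_cast hM0) hqM S (r := t / 4) (by positivity)
    have hsub : ((Finset.univ.filter fun s : F.Seed => Set.InjOn (F.hash s) S ∧
        singleEstimate t (F.hash s) S < 2 / 3 * (S.card : ℝ)).card : ℝ) ≤
        (Finset.univ.filter fun s : F.Seed =>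
          (t / 4 : ℝ) ≤ |(hitCount (F.hash s) S q : ℝ) - S.card * q / M|).card := by
      refine Nat.cast_le.2 (Finset.card_le_card (Finset.monotone_filter_right _ fun s _ hs => ?_))
      have h1 : (hitCount (F.hash s) S q : ℝ) < t :=
        Nat.cast_lt.2 (hitCount_lt_of_singleEstimate_lt ht' hs.1 hs.2).2.2
      exact le_trans (by linarith) (neg_le_abs _)
    have hW := F.card_seed_pos
    have h2 : ((Finset.univ.filter fun s : F.Seed => Set.InjOn (F.hash s) S ∧
        singleEstimate t (F.hash s) S < 2 / 3 * (S.card : ℝ)).card : ℝ) * (t / 4) ^ 2 ≤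
        3 / 2 * t * Fintype.card F.Seed :=
      (mul_le_mul_of_nonneg_right hsub (by positivity)).trans
        (h.trans (mul_le_mul_of_nonneg_right hμ hW.le))
    refine le_of_mul_le_mul_right ?_ (show (0 : ℝ) < t by linarith)
    nlinarith
  · rw [Finset.filter_false_of_mem]
    · simp
    · intro s _ hs
      have := hitCount_lt_of_singleEstimate_lt ht' hs.1 hs.2
      exact hcond ⟨this.1, this.2.1⟩

/-- A single estimate is inaccurate with probability at most `3/16`. -/
theorem HashFamily.card_not_accurate_le {u : ℕ} (hu2 : 2 ≤ u) (F : HashFamily U (u ^ 3))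
    [Nontrivial U] {t : ℕ} (ht : 576 ≤ t) (S : Finset U) (hSu : S.card ≤ u) :
    ((Finset.univ.filter fun s : F.Seed =>
      ¬ Accurate S.card (singleEstimate t (F.hash s) S)).card : ℝ) ≤
      3 / 16 * Fintype.card F.Seed := by
  have hM : 0 < u ^ 3 := by positivity
  have h1 := F.card_singleEstimate_gt_le hM (t := t) (by omega) S
  have h2 := F.card_singleEstimate_lt_le (t := t) (by omega) S
    (hSu.trans (Nat.le_self_pow (by norm_num) u))
  have h3 : ((Finset.univ.filter fun s : F.Seed => ¬ Set.InjOn (F.hash s) S).card : ℝ) ≤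
      1 / 8 * Fintype.card F.Seed := by
    have h := F.card_collision_le hM S
    have h4 : S.card * (S.card - 1) ≤ u * (u - 1) := Nat.mul_le_mul hSu (Nat.sub_le_sub_right hSu 1)
    have h5 := h.trans (Nat.mul_le_mul_right _ h4)
    have h6 : ((Finset.univ.filter fun s : F.Seed => ¬ Set.InjOn (F.hash s) S).card : ℝ) *
        (2 * (u : ℝ) ^ 3) ≤ u * (u - 1) * Fintype.card F.Seed := by
      have := (Nat.cast_le (α := ℝ)).2 h5
      push_cast [Nat.cast_sub (show 1 ≤ u by omega)] at this
      exact this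
    have hu0 : (2 : ℝ) ≤ u := by exact_mod_cast hu2
    have hW := F.card_seed_pos
    refine le_of_mul_le_mul_right (h6.trans ?_) (show (0 : ℝ) < 2 * (u : ℝ) ^ 3 by positivity)
    -- This is `u(u-2)² ≥ 0`, with equality at `u = 2`, the worst case for collisions.
    have h7 : (u : ℝ) * (u - 1) ≤ (u : ℝ) ^ 3 / 4 := by
      nlinarith [mul_nonneg (show (0 : ℝ) ≤ u by linarith) (sq_nonneg ((u : ℝ) - 2))]
    nlinarith
  have hcov : (Finset.univ.filter fun s : F.Seed =>
      ¬ Accurate S.card (singleEstimate t (F.hash s) S)) ⊆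
      (Finset.univ.filter fun s : F.Seed =>
        4 / 3 * (S.card : ℝ) < singleEstimate t (F.hash s) S) ∪
      ((Finset.univ.filter fun s : F.Seed => Set.InjOn (F.hash s) S ∧
        singleEstimate t (F.hash s) S < 2 / 3 * (S.card : ℝ)) ∪
      (Finset.univ.filter fun s : F.Seed => ¬ Set.InjOn (F.hash s) S)) := by
    intro s hs
    simp only [Accurate, Finset.mem_filter, Finset.mem_univ, true_and, not_and_or, not_le] at hs
    simp only [Finset.mem_union, Finset.mem_filter, Finset.mem_univ, true_and]
    tauto
  have h4 : ((Finset.univ.filter fun s : F.Seed =>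
      ¬ Accurate S.card (singleEstimate t (F.hash s) S)).card : ℝ) ≤ _ :=
    Nat.cast_le.2 ((Finset.card_le_card hcov).trans ((Finset.card_union_le _ _).trans
      (Nat.add_le_add_left (Finset.card_union_le _ _) _)))
  push_cast at h4
  have ht0 : (576 : ℝ) ≤ t := by exact_mod_cast ht
  have hW := F.card_seed_pos
  have h5 : ∀ a : ℕ, (a : ℝ) * 576 ≤ a * t := fun a => by gcongr
  have h6 := h5 (Finset.univ.filter fun s : F.Seed =>
        4 / 3 * (S.card : ℝ) < singleEstimate t (F.hash s) S).card
  have h7 := h5 (Finset.univ.filter fun s : F.Seed => Set.InjOn (F.hash s) S ∧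
        singleEstimate t (F.hash s) S < 2 / 3 * (S.card : ℝ)).card
  -- The three failure probabilities add up to `12/576 + 24/576 + 1/8 = 3/16`.
  linarith

end SingleEstimate

/-! ### The median of the single estimates -/

section Median

/-- If the median is not in an order-convex set given by two bounds, then at least half of the
entries are not. -/
theorem length_le_two_mul_countP {a b : ℝ} (l : List ℝ) (h : ¬ (a ≤ median l ∧ median l ≤ b)) :
    l.length ≤ 2 * l.countP fun x => decide (¬ (a ≤ x ∧ x ≤ b)) := by
  rcases l.eq_nil_or_concat with rfl | hne
  · simp
  have hl : 0 < l.length := by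
    obtain ⟨l', x, rfl⟩ := hne
    simp
  rw [← (List.perm_insertionSort (· ≤ ·) l).countP_eq]
  have hlen := List.length_insertionSort (· ≤ ·) l
  have hs := List.pairwise_insertionSort (· ≤ ·) l
  set s := l.insertionSort (· ≤ ·) with hs'
  have hi : l.length / 2 < s.length := by omega
  have hmed : median l = s[l.length / 2] := by
    rw [median, ← hs', List.getD_eq_getElem _ _ hi]
  have hmono : ∀ i j (hj : j < s.length) (hij : i ≤ j), s[i] ≤ s[j] := by
    intro i j hj hij
    rcases hij.eq_or_lt with rfl | hlt
    · exact le_rfl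
    · exact List.pairwise_iff_getElem.1 hs i j (by omega) hj hlt
  rw [hmed, not_and_or, not_le, not_le] at h
  rcases h with h | h
  · have h1 : (s.take (l.length / 2 + 1)).countP (fun x => decide (¬ (a ≤ x ∧ x ≤ b))) =
        (s.take (l.length / 2 + 1)).length := by
      refine List.countP_eq_length.2 fun x hx => ?_
      obtain ⟨j, hj, rfl⟩ := List.mem_iff_getElem.1 hx
      rw [List.length_take] at hj
      rw [List.getElem_take]
      have := hmono j (l.length / 2) hi (by omega)
      exact decide_eq_true fun hab => absurd hab.1 (not_le.2 (this.trans_lt h))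
    have h2 := (List.take_sublist (l.length / 2 + 1) s).countP_le
      (p := fun x => decide (¬ (a ≤ x ∧ x ≤ b)))
    rw [h1, List.length_take] at h2
    omega
  · have h1 : (s.drop (l.length / 2)).countP (fun x => decide (¬ (a ≤ x ∧ x ≤ b))) =
        (s.drop (l.length / 2)).length := by
      refine List.countP_eq_length.2 fun x hx => ?_
      obtain ⟨j, hj, rfl⟩ := List.mem_iff_getElem.1 hx
      rw [List.length_drop] at hj
      rw [List.getElem_drop]
      have := hmono (l.length / 2) (l.length / 2 + j) (by omega) (by omega)
      exact decide_eq_true fun hab => absurd hab.2 (not_le.2 (h.trans_le this))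
    have h2 := (List.drop_sublist (l.length / 2) s).countP_le
      (p := fun x => decide (¬ (a ≤ x ∧ x ≤ b)))
    rw [h1, List.length_drop] at h2
    omega

theorem pow_countP {α : Type*} (l : List α) (p : α → Bool) :
    (4 : ℝ) ^ l.countP p = (l.map fun x => if p x then (4 : ℝ) else 1).prod := by
  induction l with
  | nil => simp
  | cons a l ih =>
    rw [List.map_cons, List.prod_cons, ← ih, List.countP_cons]
    split_ifs <;> simp [pow_succ, mul_comm]

/-- The median estimate is inaccurate with exponentially small probability. -/
theorem HashFamily.card_estimate_not_accurate_le {U : Type*} {u : ℕ} (hu2 : 2 ≤ u)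
    (F : HashFamily U (u ^ 3)) [Nontrivial U] {t : ℕ} (ht : 576 ≤ t) (k : ℕ) (S : Finset U)
    (hSu : S.card ≤ u) :
    ((Finset.univ.filter fun σ : Fin k → F.Seed =>
      ¬ Accurate S.card (estimate F t k σ S)).card : ℝ) ≤
      (25 / 32) ^ k * Fintype.card (Fin k → F.Seed) := by
  -- Exponential Markov inequality: weight 4 for an inaccurate estimate and 1 otherwise. The mean
  -- weight is at most `1 + 3 · 3/16 = 25/16`, while a bad median forces the product of the weights
  -- to be at least `4^(k/2) = 2^k`.
  set w : F.Seed → ℝ := fun s =>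
    if ¬ Accurate S.card (singleEstimate t (F.hash s) S) then 4 else 1 with hw
  have hsum : ∑ s, w s ≤ 25 / 16 * Fintype.card F.Seed := by
    have h1 : ∀ s, w s =
        1 + 3 * if ¬ Accurate S.card (singleEstimate t (F.hash s) S) then 1 else 0 := by
      intro s
      simp only [hw]
      split_ifs <;> norm_num
    rw [Finset.sum_congr rfl fun s _ => h1 s, Finset.sum_add_distrib, ← Finset.mul_sum,
      Finset.sum_boole]
    have h2 := F.card_not_accurate_le hu2 ht S hSu
    simp only [Finset.sum_const, Finset.card_univ, nsmul_eq_mul, mul_one]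
    linarith
  have hw0 : ∀ s, 0 ≤ w s := by
    intro s
    simp only [hw]
    split_ifs <;> norm_num
  have hbad : ∀ σ : Fin k → F.Seed, ¬ Accurate S.card (estimate F t k σ S) →
      (2 : ℝ) ^ k ≤ ∏ i, w (σ i) := by
    intro σ hσ
    have h1 := length_le_two_mul_countP _ hσ
    rw [List.length_ofFn] at h1
    have h2 := pow_countP (List.ofFn fun i => singleEstimate t (F.hash (σ i)) S)
      (fun x => decide (¬ (2 / 3 * (S.card : ℝ) ≤ x ∧ x ≤ 4 / 3 * (S.card : ℝ))))
    rw [List.map_ofFn, List.prod_ofFn] at h2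
    calc (2 : ℝ) ^ k ≤ 2 ^ (2 * _) := pow_le_pow_right₀ (by norm_num) h1
      _ = 4 ^ _ := by rw [pow_mul]; congr! 1; norm_num1
      _ = _ := h2
      _ = ∏ i, w (σ i) := by
        refine Finset.prod_congr rfl fun i _ => ?_
        simp only [hw, Function.comp, decide_eq_true_eq]
        by_cases hA : Accurate S.card (singleEstimate t (F.hash (σ i)) S)
        · have hA' := hA
          rw [Accurate] at hA'
          rw [if_neg (not_not.2 hA), if_neg (not_not.2 hA')]
        · have hA' := hA
          rw [Accurate] at hA'
          rw [if_pos hA, if_pos hA']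
  have h3 : ((Finset.univ.filter fun σ : Fin k → F.Seed =>
      ¬ Accurate S.card (estimate F t k σ S)).card : ℝ) * 2 ^ k ≤
      (25 / 16 * Fintype.card F.Seed) ^ k := by
    rw [← nsmul_eq_mul]
    refine (Finset.card_nsmul_le_sum _ (fun σ : Fin k → F.Seed => ∏ i, w (σ i)) _
      fun σ hσ => hbad σ (Finset.mem_filter.1 hσ).2).trans ?_
    refine (Finset.sum_le_sum_of_subset_of_nonneg (Finset.filter_subset _ _)
      fun σ _ _ => Finset.prod_nonneg fun i _ => hw0 _).trans ?_
    -- Independence of the `k` seeds: the sum of the products factorises.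
    rw [← Fintype.sum_pow]
    exact pow_le_pow_left₀ (Finset.sum_nonneg fun s _ => hw0 s) hsum k
  rw [Fintype.card_fun, Fintype.card_fin, Nat.cast_pow, ← mul_pow]
  refine le_of_mul_le_mul_right (h3.trans (le_of_eq ?_)) (show (0 : ℝ) < 2 ^ k by positivity)
  rw [← mul_pow]
  congr 1
  ring

end Median

/-! ### Failure probabilities -/

section FailProb

variable {α β : Type*}

/-- The probability that the outcome of `p` does not satisfy `Q`. -/
noncomputable def failProb (p : PMF α) (Q : α → Prop) : ℝ≥0∞ := p.toOuterMeasure {a | ¬ Q a}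

theorem failProb_le_one (p : PMF α) (Q : α → Prop) : failProb p Q ≤ 1 := by
  rw [failProb, ← (p.toOuterMeasure_apply_eq_one_iff (s := Set.univ)).2 (Set.subset_univ _)]
  exact p.toOuterMeasure.mono (Set.subset_univ _)

theorem failProb_eq_zero {p : PMF α} {Q : α → Prop} (h : ∀ a ∈ p.support, Q a) :
    failProb p Q = 0 := by
  rw [failProb, PMF.toOuterMeasure_apply_eq_zero_iff, Set.disjoint_left]
  exact fun a ha hQ => hQ (h a ha)

theorem failProb_mono {p : PMF α} {Q R : α → Prop} (h : ∀ a, Q a → R a) :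
    failProb p R ≤ failProb p Q :=
  p.toOuterMeasure.mono fun a ha hQ => ha (h a hQ)

theorem failProb_pure_le {a : α} {Q : α → Prop} (h : Q a) : failProb (PMF.pure a) Q ≤ 0 :=
  (failProb_eq_zero fun b hb => by
    rw [PMF.mem_support_pure_iff] at hb
    exact hb ▸ h).le

/-- Union bound along a sequential experiment: either the first stage fails, or the second fails
conditionally on a good first outcome. It lets later graphs depend on earlier random choices. -/
theorem failProb_bindOnSupport_le {p : PMF α} {f : ∀ a ∈ p.support, PMF β} {Q : α → Prop}
    {R : β → Prop} {ε₁ ε₂ : ℝ≥0∞} (h₁ : failProb p Q ≤ ε₁)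
    (h₂ : ∀ a (h : a ∈ p.support), Q a → failProb (f a h) R ≤ ε₂) :
    failProb (p.bindOnSupport f) R ≤ ε₁ + ε₂ := by
  rw [failProb, PMF.toOuterMeasure_bindOnSupport_apply]
  calc _ ≤ ∑' a, ({a | ¬ Q a}.indicator p a + p a * ε₂) := by
        refine ENNReal.tsum_le_tsum fun a => ?_
        split_ifs with h0
        · simp
        · by_cases hQ : Q a
          · exact le_add_left (mul_le_mul_right (h₂ a h0 hQ) _)
          · rw [Set.indicator_of_mem (by exact hQ)]
            refine le_add_right ?_
            calc _ ≤ p a * 1 := mul_le_mul_right (failProb_le_one _ R) _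
              _ = p a := mul_one _
    _ = failProb p Q + ε₂ := by
        rw [ENNReal.tsum_add, ENNReal.tsum_mul_right, p.tsum_coe, one_mul, failProb,
          PMF.toOuterMeasure_apply]
    _ ≤ ε₁ + ε₂ := add_le_add_left h₁ _

theorem failProb_bind_le {p : PMF α} {f : α → PMF β} {Q : α → Prop}
    {R : β → Prop} {ε₁ ε₂ : ℝ≥0∞} (h₁ : failProb p Q ≤ ε₁)
    (h₂ : ∀ a ∈ p.support, Q a → failProb (f a) R ≤ ε₂) :
    failProb (p.bind f) R ≤ ε₁ + ε₂ := by
  rw [← PMF.bindOnSupport_eq_bind]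
  exact failProb_bindOnSupport_le h₁ h₂

theorem failProb_forall_le {ι : Type*} [Fintype ι] (p : PMF α) {Q : ι → α → Prop} {ε : ℝ≥0∞}
    (h : ∀ i, failProb p (Q i) ≤ ε) :
    failProb p (fun a => ∀ i, Q i a) ≤ Fintype.card ι * ε := by
  have hU : {a | ¬ ∀ i, Q i a} = ⋃ i, {a | ¬ Q i a} := by
    ext a
    simp
  rw [failProb, hU]
  refine (MeasureTheory.measure_iUnion_fintype_le p.toOuterMeasure _).trans ?_
  refine (Finset.sum_le_sum fun i _ => h i).trans ?_
  simp

theorem failProb_uniformOfFintype_le [Fintype α] [Nonempty α] {Q : α → Prop} {δ : ℝ}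
    (h : ((Finset.univ.filter fun a => ¬ Q a).card : ℝ) ≤ δ * Fintype.card α) :
    failProb (PMF.uniformOfFintype α) Q ≤ ENNReal.ofReal δ := by
  rw [failProb, PMF.toOuterMeasure_uniformOfFintype_apply]
  have hα : (0 : ℝ) < Fintype.card α := by exact_mod_cast Fintype.card_pos
  refine ENNReal.div_le_of_le_mul ?_
  rw [← ENNReal.ofReal_natCast, ← ENNReal.ofReal_natCast, ← ENNReal.ofReal_mul' hα.le]
  refine ENNReal.ofReal_le_ofReal (le_trans (le_of_eq ?_) h)
  rw [Fintype.card_subtype]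
  rfl

end FailProb

/-! ### Accuracy of all estimates in a graph -/

section Estimates

variable {V : Type*} [Fintype V]

/-- The estimates for all vertices of `H` are accurate. -/
def AccurateEstimates (H : DAG V) (e : (V → ℝ) × (V → ℝ)) : Prop :=
  ∀ v, Accurate (H.anc v).card (e.1 v) ∧ Accurate (H.ancEdges v).card (e.2 v)

theorem failProb_estimates_le [Nontrivial V] (P : Params V) (ht : 576 ≤ P.t) (H : DAG V) :
    failProb (estimates P H) (AccurateEstimates H) ≤
      2 * Fintype.card V * ENNReal.ofReal ((25 / 32) ^ P.k) := by
  set δ := ENNReal.ofReal ((25 / 32) ^ P.k) with hδ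
  have hV : 2 ≤ Fintype.card V := Fintype.one_lt_card
  have hE : 2 ≤ Fintype.card (V × V) := Fintype.one_lt_card
  have h1 : failProb (PMF.uniformOfFintype (Fin P.k → P.vertHash.Seed)) (fun σ => ∀ v,
      Accurate (H.anc v).card (estimate P.vertHash P.t P.k σ (H.anc v))) ≤
      Fintype.card V * δ :=
    failProb_forall_le _ fun v => failProb_uniformOfFintype_le
      (P.vertHash.card_estimate_not_accurate_le hV ht P.k _ (Finset.card_le_univ _))
  have h2 : failProb (PMF.uniformOfFintype (Fin P.k → P.edgeHash.Seed)) (fun τ => ∀ v,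
      Accurate (H.ancEdges v).card (estimate P.edgeHash P.t P.k τ (H.ancEdges v))) ≤
      Fintype.card V * δ :=
    failProb_forall_le _ fun v => failProb_uniformOfFintype_le
      (P.edgeHash.card_estimate_not_accurate_le hE ht P.k _ (Finset.card_le_univ _))
  have h3 : (2 : ℝ≥0∞) * Fintype.card V * δ =
      Fintype.card V * δ + (Fintype.card V * δ + 0) := by ring
  rw [h3]
  exact failProb_bind_le h1 fun σ _ hσ => failProb_bind_le h2 fun τ _ hτ =>
    failProb_pure_le fun v => ⟨hσ v, hτ v⟩

end Estimates

/-! ### What a batch achieves -/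

section Reduction

variable {V : Type*}

namespace DAG

theorem anc_remove_subset (H : DAG V) (A : Finset V) (v : V) :
    (H.remove A).anc v ⊆ H.anc v \ A := by
  intro u hu
  rw [anc, Finset.mem_filter] at hu
  have hu' := Finset.mem_sdiff.1 hu.1
  refine Finset.mem_sdiff.2 ⟨Finset.mem_filter.2 ⟨hu'.1, ?_⟩, hu'.2⟩
  exact Relation.ReflTransGen.mono (fun a b h => (Finset.mem_filter.1 h).1) _ _ hu.2

theorem ancEdges_remove_subset (H : DAG V) (B : Finset V) (v : V) :
    (H.remove (H.ancSet B)).ancEdges v ⊆ H.ancEdges v \ H.ancEdgesSet B := by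
  intro e he
  rw [ancEdges, inducedEdges, Finset.mem_filter] at he
  obtain ⟨h0, h1, h2⟩ := he
  have h1' := Finset.mem_sdiff.1 (H.anc_remove_subset _ _ h1)
  have h2' := Finset.mem_sdiff.1 (H.anc_remove_subset _ _ h2)
  refine Finset.mem_sdiff.2 ⟨Finset.mem_filter.2 ⟨(Finset.mem_filter.1 h0).1, h1'.1, h2'.1⟩, ?_⟩
  exact fun h => h1'.2 (Finset.mem_filter.1 h).2.1

theorem anc_remove_anti (H : DAG V) {A A' : Finset V} (h : A ⊆ A') (v : V) :
    (H.remove A').anc v ⊆ (H.remove A).anc v := by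
  intro u hu
  rw [anc, Finset.mem_filter] at hu ⊢
  refine ⟨Finset.sdiff_subset_sdiff subset_rfl h hu.1,
    Relation.ReflTransGen.mono (fun a b hab => ?_) _ _ hu.2⟩
  rw [remove, Finset.mem_filter] at hab ⊢
  exact ⟨hab.1, fun ha => hab.2.1 (h ha), fun hb => hab.2.2 (h hb)⟩

theorem ancEdges_remove_anti (H : DAG V) {A A' : Finset V} (h : A ⊆ A') (v : V) :
    (H.remove A').ancEdges v ⊆ (H.remove A).ancEdges v := by
  intro e he
  rw [ancEdges, inducedEdges, Finset.mem_filter] at he ⊢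
  refine ⟨?_, H.anc_remove_anti h v he.2.1, H.anc_remove_anti h v he.2.2⟩
  have := he.1
  rw [remove, Finset.mem_filter] at this ⊢
  exact ⟨this.1, fun ha => this.2.1 (h ha), fun hb => this.2.2 (h hb)⟩

theorem ancSet_mono (H : DAG V) {B B' : Finset V} (h : B ⊆ B') : H.ancSet B ⊆ H.ancSet B' :=
  Finset.biUnion_subset_biUnion_of_subset_left _ h

end DAG

/-- After the ancestors of `B` have been removed, at most a `δ`-fraction of the ancestors or of the
ancestor edges of `v` is left. -/
def Reduced (δ : ℝ) (H : DAG V) (B : Finset V) (v : V) : Prop :=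
  (((H.remove (H.ancSet B)).anc v).card : ℝ) ≤ δ * (H.anc v).card ∨
    ((H.ancEdges v).Nonempty ∧
      (((H.remove (H.ancSet B)).ancEdges v).card : ℝ) ≤ δ * (H.ancEdges v).card)

theorem Reduced.mono {δ : ℝ} {H : DAG V} {B B' : Finset V} {v : V} (h : Reduced δ H B v)
    (hB : B ⊆ B') : Reduced δ H B' v := by
  have h1 : (((H.remove (H.ancSet B')).anc v).card : ℝ) ≤ ((H.remove (H.ancSet B)).anc v).card :=
    Nat.cast_le.2 (Finset.card_le_card (H.anc_remove_anti (H.ancSet_mono hB) v))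
  have h2 : (((H.remove (H.ancSet B')).ancEdges v).card : ℝ) ≤
      ((H.remove (H.ancSet B)).ancEdges v).card :=
    Nat.cast_le.2 (Finset.card_le_card (H.ancEdges_remove_anti (H.ancSet_mono hB) v))
  exact h.imp (fun h => h1.trans h) fun h => ⟨h.1, h2.trans h.2⟩

theorem reduced_of_mem {δ : ℝ} (hδ : 0 ≤ δ) (H : DAG V) {B : Finset V} {v : V} (hv : v ∈ B) :
    Reduced δ H B v := by
  left
  have h : (H.remove (H.ancSet B)).anc v = ∅ := by
    refine Finset.subset_empty.1 ((H.anc_remove_subset _ v).trans (le_of_eq ?_))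
    exact Finset.sdiff_eq_empty_iff_subset.2 (Finset.subset_biUnion_of_mem H.anc hv)
  rw [h, Finset.card_empty, Nat.cast_zero]
  positivity

variable [Fintype V]

/-- Staleness even gives the factor `γ`; it is weakened to `4γ`, which is what pruning guarantees.
-/
theorem reduced_of_not_fresh (P : Params V) (H : DAG V) {B : Finset V} {v : V}
    (h : ¬ Fresh P H B v) : Reduced (4 * P.γ) H B v := by
  rw [Fresh, not_and_or, not_or, not_lt, not_lt] at h
  have hγ := P.γ_pos
  refine h.imp (fun h => ?_) fun h => ⟨Finset.nonempty_iff_ne_empty.2 h.1, ?_⟩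
  · have h1 : (((H.remove (H.ancSet B)).anc v).card : ℝ) ≤ (H.anc v \ H.ancSet B).card :=
      Nat.cast_le.2 (Finset.card_le_card (H.anc_remove_subset _ v))
    have h2 : (0 : ℝ) ≤ (H.anc v).card := Nat.cast_nonneg _
    nlinarith
  · have h1 : (((H.remove (H.ancSet B)).ancEdges v).card : ℝ) ≤
        (H.ancEdges v \ H.ancEdgesSet B).card :=
      Nat.cast_le.2 (Finset.card_le_card (H.ancEdges_remove_subset _ v))
    have h2 : (0 : ℝ) ≤ (H.ancEdges v).card := Nat.cast_nonneg _
    nlinarith [h.2]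

/-- The two relative errors of 1/3 cost a factor `(4/3)/(2/3) = 2` on top of the threshold `2γ`. -/
theorem le_of_ratio_le {γ : ℝ} (hγ : 0 < γ) {m m' : ℕ} {x x' : ℝ} (hm : 0 < m)
    (hx : Accurate m x) (hx' : Accurate m' x') (h : x' / x ≤ 2 * γ) : (m' : ℝ) ≤ 4 * γ * m := by
  have hm0 : (0 : ℝ) < m := Nat.cast_pos.2 hm
  have hx0 : 0 < x := lt_of_lt_of_le (by positivity) hx.1
  rw [div_le_iff₀ hx0] at h
  have h1 := hx'.1
  have h2 : 2 * γ * x ≤ 2 * γ * (4 / 3 * m) := by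
    have := hx.2
    gcongr
  linarith

/-- All vertices of `H` that are in no bucket have been reduced. -/
def ReducedOutside (P : Params V) (H : DAG V) (R B : Finset V) : Prop :=
  ∀ v ∈ H.verts, v ∉ R → Reduced (4 * P.γ) H B v

/-- A drawn vertex is either added to the batch, and then loses all its ancestors, or stale.
Reductions persist as the batch grows, so the invariant holds for every outcome of the sampling. -/
theorem sampleBucket_reducedOutside (P : Params V) (H : DAG V) (idx : V → ℕ) (i : ℕ) :
    ∀ (n : ℕ) (R B : Finset V) (s : ℕ), R.card = n → ReducedOutside P H R B →
      ∀ r ∈ (sampleBucket P H idx i R B s).support, ReducedOutside P H r.1 r.2 := by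
  intro n
  induction n using Nat.strong_induction_on with
  | _ n ih =>
    intro R B s hR hRB r hr
    rw [sampleBucket] at hr
    split_ifs at hr with h
    · rw [PMF.mem_support_bindOnSupport_iff] at hr
      obtain ⟨v, hv, hr⟩ := hr
      have hvR : v ∈ R :=
        (Finset.mem_filter.1 ((PMF.mem_support_uniformOfFinset_iff _ _).1 hv)).1
      have hc : (R.erase v).card < n := hR ▸ Finset.card_erase_lt_of_mem hvR
      split_ifs at hr with hf
      · refine ih _ hc _ _ _ rfl (fun w hw hwR => ?_) r hr
        by_cases hwv : w = v
        · have := P.γ_pos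
          exact hwv ▸ reduced_of_mem (by positivity) H (Finset.mem_insert_self _ _)
        · exact (hRB w hw fun h => hwR (Finset.mem_erase.2 ⟨hwv, h⟩)).mono
            (Finset.subset_insert _ _)
      · refine ih _ hc _ _ _ rfl (fun w hw hwR => ?_) r hr
        by_cases hwv : w = v
        · exact hwv ▸ reduced_of_not_fresh P H hf
        · exact hRB w hw fun h => hwR (Finset.mem_erase.2 ⟨hwv, h⟩)
    · rw [PMF.support_pure, Set.mem_singleton_iff] at hr
      exact hr ▸ hRB

theorem sampleBuckets_reducedOutside (P : Params V) (H : DAG V) (idx : V → ℕ) :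
    ∀ (j : ℕ) (R B : Finset V), ReducedOutside P H R B →
      ∀ r ∈ (sampleBuckets P H idx j R B).support, ReducedOutside P H r.1 r.2 := by
  intro j
  induction j with
  | zero =>
    intro R B hRB r hr
    rw [sampleBuckets, PMF.support_pure, Set.mem_singleton_iff] at hr
    exact hr ▸ hRB
  | succ j ih =>
    intro R B hRB r hr
    rw [sampleBuckets, PMF.mem_support_bind_iff] at hr
    obtain ⟨q, hq, hr⟩ := hr
    exact ih _ _ (sampleBucket_reducedOutside P H idx j _ _ _ _ rfl hRB q hq) r hr

variable {P : Params V} {ε : ℝ≥0∞}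

theorem failProb_prune_le (hε : ∀ H, failProb (estimates P H) (AccurateEstimates H) ≤ ε)
    (H : DAG V) {R B : Finset V} (hRB : ReducedOutside P H R B) :
    failProb (prune P H B R) (fun R' => ReducedOutside P H R' B) ≤ 2 * ε := by
  have h : 2 * ε = ε + (ε + 0) := by ring
  rw [h]
  refine failProb_bind_le (hε H) fun e _ he => failProb_bind_le (hε _) fun e' _ he' =>
    failProb_pure_le fun v hv hvR => ?_
  by_cases hR : v ∈ R
  · rw [Finset.mem_filter, not_and, not_not] at hvR
    rcases hvR hR with hr | ⟨h0, hr⟩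
    · exact Or.inl (le_of_ratio_le P.γ_pos (Finset.card_pos.2 ⟨v, H.self_mem_anc hv⟩)
        (he v).1 (he' v).1 hr)
    -- An accurate estimate of an empty set is exactly 0, so a nonzero estimate certifies an edge.
    · have hne : (H.ancEdges v).Nonempty := by
        by_contra hne
        rw [Finset.not_nonempty_iff_eq_empty] at hne
        have hacc := (he v).2
        rw [hne, Accurate, Finset.card_empty, Nat.cast_zero, mul_zero, mul_zero] at hacc
        exact h0 (le_antisymm hacc.2 hacc.1)
      exact Or.inr ⟨hne, le_of_ratio_le P.γ_pos (Finset.card_pos.2 hne) (he v).2 (he' v).2 hr⟩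
  · exact hRB v hv hR

theorem failProb_samplePass_le (hε : ∀ H, failProb (estimates P H) (AccurateEstimates H) ≤ ε)
    (H : DAG V) (idx : V → ℕ) {R B : Finset V} (hRB : ReducedOutside P H R B) :
    failProb (samplePass P H idx R B) (fun r => ReducedOutside P H r.1 r.2) ≤ 2 * ε := by
  have h : 2 * ε = 0 + (2 * ε + 0) := by ring
  rw [h]
  exact failProb_bind_le (failProb_eq_zero (sampleBuckets_reducedOutside P H idx _ R B hRB)).le
    fun r _ hr => failProb_bind_le (failProb_prune_le hε H hr) fun R' _ hR' => failProb_pure_le hR'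

/-- Every vertex of `H` has been reduced by the batch `B`. -/
def IsGoodBatch (P : Params V) (H : DAG V) (B : Finset V) : Prop :=
  ∀ v ∈ H.verts, Reduced (4 * P.γ) H B v

/-- Every pass removes a vertex from the buckets, so there are at most `n` passes, each failing with
probability at most `2ε`. When the buckets are empty, the invariant covers all vertices. -/
theorem failProb_batchLoop_le (hε : ∀ H, failProb (estimates P H) (AccurateEstimates H) ≤ ε)
    (H : DAG V) (idx : V → ℕ) :
    ∀ (n : ℕ) (R B : Finset V), R.card = n → ReducedOutside P H R B →
      failProb (batchLoop P H idx R B) (IsGoodBatch P H) ≤ n * (2 * ε) := by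
  intro n
  induction n using Nat.strong_induction_on with
  | _ n ih =>
    intro R B hR hRB
    rw [batchLoop]
    split_ifs with h
    · have hn : (n : ℝ≥0∞) * (2 * ε) = 2 * ε + (n - 1 : ℕ) * (2 * ε) := by
        have h1 : n = n - 1 + 1 := by
          have := Finset.card_pos.2 h
          omega
        conv_lhs => rw [h1]
        push_cast
        ring
      rw [hn]
      refine failProb_bindOnSupport_le (failProb_samplePass_le hε H idx hRB) fun r hr hgood => ?_
      have hc : r.1.card < n := hR ▸ Finset.card_lt_card (samplePass_support P H idx R B h r hr).1
      refine (ih _ hc r.1 r.2 rfl hgood).trans ?_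
      have : r.1.card ≤ n - 1 := by omega
      gcongr
    · rw [Finset.not_nonempty_iff_eq_empty] at h
      exact (failProb_pure_le fun v hv => hRB v hv (h ▸ Finset.notMem_empty v)).trans
        zero_le

/-- The initial estimates only determine the buckets, and the reduction holds for any assignment to
buckets. Hence they need not be accurate, and the condition `Q` on them is trivial. -/
theorem failProb_findBatch_le (hε : ∀ H, failProb (estimates P H) (AccurateEstimates H) ≤ ε)
    (H : DAG V) :
    failProb (findBatch P H) (IsGoodBatch P H) ≤ 2 * Fintype.card V * ε := by
  have h : failProb (findBatch P H) (IsGoodBatch P H) ≤ 0 + H.verts.card * (2 * ε) :=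
    failProb_bind_le (Q := fun _ => True) (failProb_eq_zero fun _ _ => trivial).le fun e _ _ =>
      failProb_batchLoop_le hε H _ _ _ _ rfl fun v hv hvH => absurd hv hvH
  refine h.trans ?_
  have h2 : H.verts.card ≤ Fintype.card V := Finset.card_le_univ _
  calc _ = (H.verts.card : ℝ≥0∞) * (2 * ε) := zero_add _
    _ ≤ (Fintype.card V : ℝ≥0∞) * (2 * ε) := by gcongr
    _ = _ := by ring

/-- The sequence of batches is one that the algorithm can produce, and all its batches are good. -/
def IsGoodRun (P : Params V) : DAG V → List (Finset V) → Prop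
  | H, [] => H.verts = ∅
  | H, B :: L => H.verts.Nonempty ∧ IsGoodBatch P H B ∧ IsGoodRun P (H.remove (H.ancSet B)) L

theorem failProb_scheduleSmallSubgraph_le
    (hε : ∀ H, failProb (estimates P H) (AccurateEstimates H) ≤ ε) :
    ∀ (n : ℕ) (H : DAG V), H.verts.card = n →
      failProb (scheduleSmallSubgraph P H) (IsGoodRun P H) ≤
        n * (2 * Fintype.card V * ε) := by
  intro n
  induction n using Nat.strong_induction_on with
  | _ n ih =>
    intro H hH
    rw [scheduleSmallSubgraph]
    split_ifs with h
    · have hn : (n : ℝ≥0∞) * (2 * Fintype.card V * ε) =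
          2 * Fintype.card V * ε + ((n - 1 : ℕ) * (2 * Fintype.card V * ε) + 0) := by
        have h1 : n = n - 1 + 1 := by
          have := Finset.card_pos.2 h
          omega
        conv_lhs => rw [h1]
        push_cast
        ring
      rw [hn]
      refine failProb_bindOnSupport_le (failProb_findBatch_le hε H) fun B hB hgood => ?_
      have hc := findBatch_progress P H h B hB
      refine failProb_bind_le ((ih _ (hH ▸ hc) _ rfl).trans ?_) fun L _ hL =>
        failProb_pure_le ⟨h, hgood, hL⟩
      have : (H.remove (H.ancSet B)).verts.card ≤ n - 1 := by omega
      gcongr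
    · rw [Finset.not_nonempty_iff_eq_empty] at h
      exact (failProb_pure_le (Q := IsGoodRun P H) (by rw [IsGoodRun]; exact h)).trans zero_le

end Reduction

/-! ### The number of batches of a good run -/

section Length

variable {V : Type*}

namespace DAG

/-- Every ancestor other than `v` is the tail of the first edge of a path to `v`, and that edge is
an ancestor edge. -/
theorem card_anc_le (H : DAG V) (v : V) : (H.anc v).card ≤ (H.ancEdges v).card + 1 := by
  have h : H.anc v ⊆ insert v ((H.ancEdges v).image Prod.fst) := by
    intro u hu
    rw [Finset.mem_insert]
    have hu' := (Finset.mem_filter.1 hu).2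
    rcases hu'.cases_head with rfl | ⟨w, huw, hwv⟩
    · exact Or.inl rfl
    · refine Or.inr (Finset.mem_image.2 ⟨(u, w), Finset.mem_filter.2 ⟨huw, hu, ?_⟩, rfl⟩)
      exact Finset.mem_filter.2 ⟨(H.edges_mem _ huw).2, hwv⟩
  exact (Finset.card_le_card h).trans
    ((Finset.card_insert_le _ _).trans (Nat.add_le_add_right Finset.card_image_le 1))

/-- By acyclicity the ancestor edges and their reversals are disjoint subsets of the ordered pairs
of ancestors. -/
theorem two_mul_card_ancEdges_le (H : DAG V) (v : V) :
    2 * (H.ancEdges v).card ≤ (H.anc v).card ^ 2 := by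
  have hdisj : Disjoint (H.ancEdges v) ((H.ancEdges v).image Prod.swap) := by
    rw [Finset.disjoint_left]
    rintro ⟨a, b⟩ hab hba
    obtain ⟨⟨c, d⟩, hcd, h⟩ := Finset.mem_image.1 hba
    obtain ⟨rfl, rfl⟩ := Prod.mk.inj h
    exact H.acyclic d (Relation.TransGen.tail
      (Relation.TransGen.single (Finset.mem_filter.1 hab).1) (Finset.mem_filter.1 hcd).1)
  have hsub : H.ancEdges v ∪ (H.ancEdges v).image Prod.swap ⊆ H.anc v ×ˢ H.anc v := by
    refine Finset.union_subset (fun e he => ?_) fun e he => ?_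
    · exact Finset.mem_product.2 (Finset.mem_filter.1 he).2
    · obtain ⟨f, hf, rfl⟩ := Finset.mem_image.1 he
      exact Finset.mem_product.2 (Finset.mem_filter.1 hf).2.symm
  have := Finset.card_le_card hsub
  rw [Finset.card_union_of_disjoint hdisj, Finset.card_image_of_injective _ Prod.swap_injective,
    Finset.card_product] at this
  rw [sq]
  omega

end DAG

/-- The numbers of ancestors and of ancestor edges of a vertex that survives all but the last one
of `T` batches, where each batch reduces one of the two numbers by the factor `δ`. -/
structure Shrinking (δ : ℝ) (T : ℕ) (a e : ℕ → ℕ) : Prop where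
  one_le : ∀ i < T, 1 ≤ a i
  le_add_one : ∀ i, a i ≤ e i + 1
  two_mul_le : ∀ i, 2 * e i ≤ a i ^ 2
  vert_le : ∀ i, i + 1 < T → a (i + 1) ≤ a i
  edge_le : ∀ i, i + 1 < T → e (i + 1) ≤ e i
  step : ∀ i, i + 1 < T → (a (i + 1) : ℝ) ≤ δ * a i ∨ (1 ≤ e i ∧ (e (i + 1) : ℝ) ≤ δ * e i)

namespace Shrinking

variable {δ : ℝ} {T : ℕ} {a e : ℕ → ℕ}

/-- Without an edge at time `T - 2` the vertex would be its own only ancestor. The next batch could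
then reduce neither number without removing the vertex, which is still present at time `T - 1`. -/
theorem one_le_edge (h : Shrinking δ T a e) (hδ1 : δ < 1) (hδ0 : 0 < δ) {s : ℕ}
    (hs : s + 2 = T) : ∀ i ≤ s, 1 ≤ e i := by
  have hlast : 1 ≤ e s := by
    by_contra h0
    have h1 := h.le_add_one s
    rcases h.step s (by omega) with h2 | h2
    · have h3 : (1 : ℝ) ≤ a (s + 1) := by exact_mod_cast h.one_le (s + 1) (by omega)
      have h4 : (a s : ℝ) ≤ 1 := by exact_mod_cast (by omega : a s ≤ 1)
      nlinarith
    · exact h0 h2.1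
  intro i hi
  induction hi using Nat.decreasingInduction with
  | self => exact hlast
  | of_succ j hj ih => exact ih.trans (h.edge_le j (by omega))

theorem two_le_vert (h : Shrinking δ T a e) {i : ℕ} (hi : 1 ≤ e i) : 2 ≤ a i := by
  have := h.two_mul_le i
  by_contra hlt
  have : a i ≤ 1 := by omega
  have : a i ^ 2 ≤ 1 := by
    calc a i ^ 2 ≤ 1 ^ 2 := Nat.pow_le_pow_left this 2
      _ = 1 := rfl
  omega

/-- Here `α` and `β` count the steps charged to ancestors and to edges. -/
theorem exists_exponents (h : Shrinking δ T a e) (hδ0 : 0 < δ) :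
    ∀ j < T, ∃ α β : ℕ, α + β = j ∧ (a j : ℝ) ≤ δ ^ α * a 0 ∧ (e j : ℝ) ≤ δ ^ β * e 0 := by
  intro j
  induction j with
  | zero => exact fun _ => ⟨0, 0, rfl, by simp, by simp⟩
  | succ j ih =>
    intro hj
    obtain ⟨α, β, hαβ, ha, he⟩ := ih (by omega)
    have ha' : (a (j + 1) : ℝ) ≤ a j := by exact_mod_cast h.vert_le j hj
    have he' : (e (j + 1) : ℝ) ≤ e j := by exact_mod_cast h.edge_le j hj
    rcases h.step j hj with h1 | ⟨-, h1⟩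
    · refine ⟨α + 1, β, by omega, h1.trans ?_, he'.trans he⟩
      calc δ * a j ≤ δ * (δ ^ α * a 0) := by gcongr
        _ = _ := by ring
    · refine ⟨α, β + 1, by omega, ha'.trans ha, h1.trans ?_⟩
      calc δ * e j ≤ δ * (δ ^ β * e 0) := by gcongr
        _ = _ := by ring

/-- Three successive reductions that leave an edge require many ancestors at the beginning. -/
theorem one_le_of_three (h : Shrinking δ T a e) (hT : 4 ≤ T) (hδ0 : 0 < δ) (hδ1 : δ < 1)
    (h3 : 1 ≤ e 3) {X : ℝ} (hX : (a 0 : ℝ) ≤ X) : 1 ≤ δ ^ 5 * X ^ 4 := by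
  by_contra! hlt
  have hX0 : 0 ≤ X := le_trans (Nat.cast_nonneg _) hX
  have hA : δ ^ 2 * X < 1 := by
    refine lt_of_pow_lt_pow_left₀ 4 zero_le_one ?_
    calc (δ ^ 2 * X) ^ 4 = δ ^ 3 * (δ ^ 5 * X ^ 4) := by ring
      _ ≤ 1 * (δ ^ 5 * X ^ 4) := by gcongr; exact pow_le_one₀ hδ0.le hδ1.le
      _ < 1 ^ 4 := by linarith
  have hE : δ ^ 3 * X ^ 2 < 1 := by
    refine lt_of_pow_lt_pow_left₀ 2 zero_le_one ?_
    calc (δ ^ 3 * X ^ 2) ^ 2 = δ * (δ ^ 5 * X ^ 4) := by ring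
      _ ≤ 1 * (δ ^ 5 * X ^ 4) := by gcongr
      _ < 1 ^ 2 := by linarith
  have ha3 : (2 : ℝ) ≤ a 3 := by exact_mod_cast h.two_le_vert h3
  have he3 : (1 : ℝ) ≤ e 3 := by exact_mod_cast h3
  have hle2 : (a 2 : ℝ) ≤ e 2 + 1 := by exact_mod_cast h.le_add_one 2
  have hsq : ∀ i, 2 * (e i : ℝ) ≤ (a i : ℝ) ^ 2 := fun i => by exact_mod_cast h.two_mul_le i
  obtain ⟨α, β, hαβ, ha, he⟩ := h.exists_exponents hδ0 2 (by omega)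
  have he0 : (e 0 : ℝ) ≤ X ^ 2 / 2 := by
    have := hsq 0
    have : (a 0 : ℝ) ^ 2 ≤ X ^ 2 := by gcongr
    linarith
  have hcase : (a 2 : ℝ) ≤ δ * X ∨ (e 2 : ℝ) ≤ δ ^ 2 * (X ^ 2 / 2) := by
    rcases Nat.eq_zero_or_pos α with h0 | h0
    · obtain rfl : β = 2 := by omega
      exact Or.inr (he.trans (by gcongr))
    · refine Or.inl (ha.trans ?_)
      calc δ ^ α * a 0 ≤ δ ^ 1 * X :=
            mul_le_mul (pow_le_pow_of_le_one hδ0.le hδ1.le h0) hX (Nat.cast_nonneg _)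
              (by positivity)
        _ = δ * X := by rw [pow_one]
  -- One reduction of the ancestors is worth two of the edges, because the edge bound is quadratic
  -- in the number of ancestors.
  have he2 : (e 2 : ℝ) ≤ δ ^ 2 * (X ^ 2 / 2) := by
    rcases hcase with h1 | h1
    · have := hsq 2
      have : (a 2 : ℝ) ^ 2 ≤ (δ * X) ^ 2 := by gcongr
      nlinarith
    · exact h1
  -- With `δ³X² < 1`, a third reduction of the ancestors would give `a 3 ≤ δ(e 2 + 1) < 3/2`, and
  -- one of the edges `e 3 < 1/2`.
  rcases h.step 2 (by omega) with h1 | ⟨-, h1⟩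
  · have h2 : δ * (a 2 : ℝ) ≤ δ * (e 2 + 1) := by gcongr
    have h4 : δ * (e 2 : ℝ) ≤ δ * (δ ^ 2 * (X ^ 2 / 2)) := by gcongr
    norm_num at h1
    nlinarith
  · have h4 : δ * (e 2 : ℝ) ≤ δ * (δ ^ 2 * (X ^ 2 / 2)) := by gcongr
    norm_num at h1
    nlinarith

theorem length_le (h : Shrinking δ T a e) (hδ0 : 0 < δ) (hδ1 : δ < 1) {X : ℝ} (hX1 : 1 < X)
    (hX : (a 0 : ℝ) ≤ X) : (T : ℝ) ≤ max 3 (4 * Real.logb (1 / δ) X) := by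
  by_contra! hlt
  obtain ⟨hT3, hTL⟩ := max_lt_iff.1 hlt
  have hT : 3 < T := by exact_mod_cast hT3
  obtain ⟨s, rfl⟩ : ∃ s, T = s + 2 := ⟨T - 2, by omega⟩
  have hs2 : 2 ≤ s := by omega
  have hes := h.one_le_edge hδ1 hδ0 rfl s le_rfl
  have has := h.two_le_vert hes
  set L := Real.logb (1 / δ) X with hL
  have hx1 : 1 < 1 / δ := by rw [lt_div_iff₀ hδ0]; linarith
  have hX0 : 0 < X := by linarith
  have hlog : ∀ m k : ℕ, 1 < δ ^ m * X ^ k → (m : ℝ) < k * L := by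
    intro m k hmk
    have h1 : (1 / δ) ^ m < X ^ k := by
      rw [one_div, inv_pow, inv_lt_iff_one_lt_mul₀ (by positivity)]
      linarith
    have h2 := Real.logb_lt_logb hx1 (by positivity) h1
    rwa [Real.logb_pow, Real.logb_pow, Real.logb_self_eq_one hx1, mul_one] at h2
  have hlog' : ∀ m k : ℕ, 1 ≤ δ ^ m * X ^ k → (m : ℝ) ≤ k * L := by
    intro m k hmk
    have h1 : (1 / δ) ^ m ≤ X ^ k := by
      rw [one_div, inv_pow, inv_le_iff_one_le_mul₀ (by positivity)]
      linarith
    have h2 := Real.logb_le_logb_of_le hx1 (by positivity) h1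
    rwa [Real.logb_pow, Real.logb_pow, Real.logb_self_eq_one hx1, mul_one] at h2
  obtain ⟨α, β, hαβ, ha, he⟩ := h.exists_exponents hδ0 s (by omega)
  have has' : (2 : ℝ) ≤ a s := by exact_mod_cast has
  have hes' : (1 : ℝ) ≤ e s := by exact_mod_cast hes
  have he0 : (e 0 : ℝ) ≤ X ^ 2 / 2 := by
    have h1 : 2 * (e 0 : ℝ) ≤ (a 0 : ℝ) ^ 2 := by exact_mod_cast h.two_mul_le 0
    have : (a 0 : ℝ) ^ 2 ≤ X ^ 2 := by gcongr
    linarith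
  -- The surviving edge and its two ends bound the exponents: `2 ≤ δ^α X` and `1 ≤ δ^β X²/2`.
  have hα : (α : ℝ) < L := by
    have h1 : δ ^ α * a 0 ≤ δ ^ α * X := by gcongr
    simpa using hlog α 1 (by rw [pow_one]; linarith)
  have hβ : (β : ℝ) < 2 * L := by
    have h1 : δ ^ β * (e 0 : ℝ) ≤ δ ^ β * (X ^ 2 / 2) := by gcongr
    simpa using hlog β 2 (by linarith)
  have hsr : (s : ℝ) = α + β := by exact_mod_cast hαβ.symm
  have hs2' : (2 : ℝ) ≤ s := by exact_mod_cast hs2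
  push_cast at hTL
  -- If all `s` steps were charged to edges, then `s < 2L < (s + 2)/2`, contradicting `s ≥ 2`. From
  -- `α ≥ 1` it follows that `L > 1`.
  have hα1 : 1 ≤ α := by
    by_contra h0
    have h0 : (α : ℝ) = 0 := by exact_mod_cast (by omega : α = 0)
    linarith
  have hα1' : (1 : ℝ) ≤ α := by exact_mod_cast hα1
  have hs3 : 3 ≤ s := by
    have : (2 : ℝ) < s := by linarith
    exact_mod_cast this
  -- If `α ≥ 2`, then `L > 2`, but `4L < s + 2 < 3L + 2` forces `L < 2`.
  have hα2 : (α : ℝ) ≤ 1 := by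
    by_contra hgt
    have h2 : 2 ≤ α := by
      have : (1 : ℝ) < α := by linarith
      exact_mod_cast this
    have : (2 : ℝ) ≤ α := by exact_mod_cast h2
    linarith
  have hs4 : s < 4 := by
    have : (s : ℝ) < 4 := by linarith
    exact_mod_cast this
  obtain rfl : s = 3 := by omega
  -- Only `T = 5` is left; `1 ≤ δ⁵X⁴` says precisely that `5 ≤ 4L`.
  have h5 := hlog' 5 4 (h.one_le_of_three (by omega) hδ0 hδ1 hes hX)
  norm_num at h5 hTL
  linarith

end Shrinking

variable [Fintype V] {P : Params V}

/-- Any vertex present at the start of the last batch works: vertex sets only shrink, so it was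
present at all earlier times. -/
theorem IsGoodRun.exists_survivor : ∀ {L : List (Finset V)} {H : DAG V}, IsGoodRun P H L →
    L ≠ [] → ∃ (G : ℕ → DAG V) (v : V), G 0 = H ∧ (∀ i < L.length, v ∈ (G i).verts) ∧
      ∀ i, i + 1 < L.length →
        ∃ B, G (i + 1) = (G i).remove ((G i).ancSet B) ∧ IsGoodBatch P (G i) B
  | [], _, _, h => absurd rfl h
  | [B], H, hL, _ => by
    obtain ⟨v, hv⟩ := hL.1
    exact ⟨fun _ => H, v, rfl, fun _ _ => hv, fun i hi => absurd hi (by simp)⟩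
  | B :: B' :: L, H, hL, _ => by
    obtain ⟨G, v, hG, hv, hstep⟩ := IsGoodRun.exists_survivor hL.2.2 (List.cons_ne_nil B' L)
    refine ⟨fun i => Nat.casesOn i H G, v, rfl, fun i hi => ?_, fun i hi => ?_⟩
    · cases i with
      | zero =>
        have := hv 0 (by simp)
        rw [hG] at this
        exact (Finset.mem_sdiff.1 this).1
      | succ i => exact hv i (by simpa using hi)
    · cases i with
      | zero => exact ⟨B, hG, hL.2.1⟩
      | succ i => exact hstep i (by simpa using hi)

theorem IsGoodRun.length_le {L : List (Finset V)} {H : DAG V} (hL : IsGoodRun P H L) {ρ : ℕ}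
    (hρ : 1 < ρ) (hH : H.IsSmall ρ) (hγ : P.γ < 1 / 4) :
    (L.length : ℝ) ≤ max 3 (4 * Real.logb (1 / (4 * P.γ)) (2 * (ρ : ℝ))) := by
  rcases eq_or_ne L [] with rfl | hne
  · exact le_max_of_le_left (by simp)
  obtain ⟨G, v, hG, hv, hstep⟩ := hL.exists_survivor hne
  have hγ0 := P.γ_pos
  have hρ' : (1 : ℝ) < ρ := by exact_mod_cast hρ
  refine Shrinking.length_le (a := fun i => ((G i).anc v).card)
    (e := fun i => ((G i).ancEdges v).card) ?_ (by linarith) (by linarith) (by linarith) ?_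
  · refine ⟨fun i hi => Finset.card_pos.2 ⟨v, (G i).self_mem_anc (hv i hi)⟩,
      fun i => (G i).card_anc_le v, fun i => (G i).two_mul_card_ancEdges_le v,
      fun i hi => ?_, fun i hi => ?_, fun i hi => ?_⟩
    all_goals obtain ⟨B, hB, hgood⟩ := hstep i hi
    · rw [hB]
      exact Finset.card_le_card (((G i).anc_remove_subset _ v).trans Finset.sdiff_subset)
    · rw [hB]
      exact Finset.card_le_card (((G i).ancEdges_remove_subset _ v).trans Finset.sdiff_subset)
    · rw [hB]
      exact (hgood v (hv i (by omega))).imp_right fun h => ⟨Finset.card_pos.2 h.1, h.2⟩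
  · have h0 := hv 0 (List.length_pos_iff.2 hne)
    rw [hG] at h0 ⊢
    exact_mod_cast hH v h0

end Length

/-! ### The probability of a good run -/

section Main

theorem one_sub_le_toReal_of_failProb_le {α : Type*} {p : PMF α} {Q : α → Prop} {x : ℝ}
    (hx : 0 ≤ x) (h : failProb p Q ≤ ENNReal.ofReal x) :
    1 - x ≤ (p.toOuterMeasure {a | Q a}).toReal := by
  have huniv : p.toOuterMeasure Set.univ = 1 :=
    (p.toOuterMeasure_apply_eq_one_iff _).2 (Set.subset_univ _)
  have hle : p.toOuterMeasure {a | Q a} ≤ 1 := huniv ▸ p.toOuterMeasure.mono (Set.subset_univ _)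
  have h1 : (1 : ℝ≥0∞) ≤ p.toOuterMeasure {a | Q a} + ENNReal.ofReal x := by
    rw [← huniv, ← Set.union_compl_self {a | Q a}]
    exact (MeasureTheory.measure_union_le _ _).trans (add_le_add_right h _)
  have htop := ne_top_of_le_ne_top ENNReal.one_ne_top hle
  have h2 := ENNReal.toReal_mono (ENNReal.add_ne_top.2 ⟨htop, ENNReal.ofReal_ne_top⟩) h1
  rw [ENNReal.toReal_add htop ENNReal.ofReal_ne_top, ENNReal.toReal_ofReal hx,
    ENNReal.toReal_one] at h2
  linarith

theorem pow_le_rpow_neg {n k : ℕ} (hn : 2 ≤ n) {b c : ℝ} (hc : b / Real.log (32 / 25) ≤ c)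
    (hk : c * Real.log n ≤ k) : (25 / 32 : ℝ) ^ k ≤ (n : ℝ) ^ (-b) := by
  have hn0 : (0 : ℝ) < n := by positivity
  have hl : 0 < Real.log (32 / 25) := Real.log_pos (by norm_num)
  have hln : 0 ≤ Real.log n := Real.log_natCast_nonneg n
  have hinv : Real.log (25 / 32) = -Real.log (32 / 25) := by
    rw [← Real.log_inv]
    norm_num
  rw [← Real.rpow_natCast, Real.rpow_def_of_pos (by norm_num), Real.rpow_def_of_pos hn0, hinv]
  refine Real.exp_le_exp.2 ?_
  rw [div_le_iff₀ hl] at hc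
  have h1 : c * Real.log n * Real.log (32 / 25) ≤ k * Real.log (32 / 25) := by gcongr
  have h2 : b * Real.log n ≤ c * Real.log (32 / 25) * Real.log n := by gcongr
  linarith

/-- For `n ≥ 2` the factor `4n³` is at most `n⁵`, which explains the summand 5 in `d + 5`. -/
theorem four_mul_cube_mul_pow_le {n k : ℕ} (hn : 2 ≤ n) {d c : ℝ}
    (hc : (d + 5) / Real.log (32 / 25) ≤ c) (hk : c * Real.log n ≤ k) :
    (4 * (n : ℝ) ^ 3) * (25 / 32) ^ k ≤ 1 / (n : ℝ) ^ d := by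
  have hn2 : (2 : ℝ) ≤ n := by exact_mod_cast hn
  have hn0 : (0 : ℝ) < n := by linarith
  calc (4 * (n : ℝ) ^ 3) * (25 / 32) ^ k ≤ (n : ℝ) ^ 5 * (n : ℝ) ^ (-(d + 5)) := by
        have h1 : 4 * (n : ℝ) ^ 3 ≤ (n : ℝ) ^ 5 := by
          have : (2 : ℝ) ^ 2 ≤ (n : ℝ) ^ 2 := by gcongr
          calc 4 * (n : ℝ) ^ 3 ≤ (n : ℝ) ^ 2 * (n : ℝ) ^ 3 := by gcongr; linarith
            _ = _ := by ring
        have h2 := pow_le_rpow_neg hn hc hk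
        gcongr
    _ = 1 / (n : ℝ) ^ d := by
        rw [← Real.rpow_natCast, ← Real.rpow_add hn0, one_div, ← Real.rpow_neg hn0.le]
        congr 1
        push_cast
        ring

theorem failProb_isGoodRun_le {V : Type*} [Fintype V] (P : Params V) (H : DAG V) {c d : ℝ}
    (ht : 576 ≤ P.t) (hc : (d + 5) / Real.log (32 / 25) ≤ c)
    (hk : c * Real.log (Fintype.card V) ≤ P.k) :
    failProb (scheduleSmallSubgraph P H) (IsGoodRun P H) ≤
      ENNReal.ofReal (1 / (Fintype.card V : ℝ) ^ d) := by
  have hcard : H.verts.card ≤ Fintype.card V := Finset.card_le_univ _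
  rcases lt_trichotomy (Fintype.card V) 1 with hV | hV | hV
  -- The accuracy bounds need two elements. With no vertices there is nothing to fail, so any `ε`
  -- serves; with one vertex the allowed failure probability is 1.
  · have h := failProb_scheduleSmallSubgraph_le (P := P) (ε := 1)
      (fun H => failProb_le_one _ _) _ H rfl
    have h0 : H.verts.card = 0 := by omega
    rw [h0, Nat.cast_zero, zero_mul] at h
    exact h.trans zero_le
  · rw [hV, Nat.cast_one, Real.one_rpow, div_one, ENNReal.ofReal_one]
    exact failProb_le_one _ _
  · have : Nontrivial V := Fintype.one_lt_card_iff_nontrivial.1 hV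
    refine (failProb_scheduleSmallSubgraph_le (failProb_estimates_le P ht) _ H rfl).trans ?_
    refine le_trans ?_ (ENNReal.ofReal_le_ofReal (four_mul_cube_mul_pow_le hV hc hk))
    rw [ENNReal.ofReal_mul (by positivity)]
    have h4 : ENNReal.ofReal (4 * (Fintype.card V : ℝ) ^ 3) = 4 * (Fintype.card V : ℝ≥0∞) ^ 3 := by
      rw [ENNReal.ofReal_mul (by norm_num), ENNReal.ofReal_pow (by positivity),
        ENNReal.ofReal_natCast, ENNReal.ofReal_ofNat]
    rw [h4]
    calc _ ≤ (Fintype.card V : ℝ≥0∞) * (2 * Fintype.card V *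
          (2 * Fintype.card V * ENNReal.ofReal ((25 / 32) ^ P.k))) := by gcongr
      _ = _ := by ring

end Main
end BatchScheduling

theorem mainTheorem6 :
    ∃ c₀ : ℕ, ∀ c : ℕ, c₀ ≤ c → ∀ d : ℝ, 1 ≤ d → ∃ c₁ : ℕ, ∀ c' : ℕ, c₁ ≤ c' →
      ∀ (V : Type*) [Fintype V] (P : BatchScheduling.Params V) (H : BatchScheduling.DAG V) (ρ : ℕ),
        1 < ρ → H.IsSmall ρ → P.γ < 1 / 4 → P.t = 9 * c →
        P.k = ⌈(c' : ℝ) * Real.log (Fintype.card V : ℝ)⌉₊ →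
        1 - 1 / (Fintype.card V : ℝ) ^ d ≤
          ((BatchScheduling.scheduleSmallSubgraph P H).toOuterMeasure
            {L | (L.length : ℝ) ≤ max 3 (4 * Real.logb (1 / (4 * P.γ)) (2 * (ρ : ℝ)))}).toReal := by
  -- `9 · 64 = 576` is the number of kept hash values that the bound 3/16 requires.
  refine ⟨64, fun c hc d _ => ⟨⌈(d + 5) / Real.log (32 / 25)⌉₊, ?_⟩⟩
  intro c' hc' V _ P H ρ hρ hH hγ ht hk
  refine BatchScheduling.one_sub_le_toReal_of_failProb_le (by positivity) ?_
  refine (BatchScheduling.failProb_mono fun L hL =>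
    BatchScheduling.IsGoodRun.length_le hL hρ hH hγ).trans ?_
  exact BatchScheduling.failProb_isGoodRun_le P H (by omega) (Nat.ceil_le.1 hc')
    (hk ▸ Nat.le_ceil _)
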